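/- Let $d\ge2$ be an integer, $\nu(z)=1-z^2$ on $(-1,1)$, and let $d\nu_d=Z_d^{-1}\,\nu^{\frac d2-1}\,dz$ with $Z_d=\sqrt\pi\,\Gamma(\frac d2)/\Gamma(\frac{d+1}2)$, which is a probability measure on $(-1,1)$. Write $\|f\|_q=\big(\int_{-1}^1|f|^q\,d\nu_d\big)^{1/q}$, let $\mathcal L f=(1-z^2)\,f''-d\,z\,f'$ be the ultraspherical operator, and let $\mathrm H^1((-1,1),d\nu_d)$ be the space of the real functions $f\in\mathrm L^2((-1,1),d\nu_d)$ with a weak derivative $f'$ such that $\int_{-1}^1|f'|^2\,\nu\,d\nu_d<\infty$. Let $2^\#=\frac{2d^2+1}{(d-1)^2}$ and, for $p\in(2,2^\#)$, $$\lambda^\star:=\inf_v\ \frac{\int_{-1}^1(\mathcal L v)^2\,d\nu_d}{\int_{-1}^1|v'|^2\,\nu\,d\nu_d},$$ where the infimum is taken over all non-constant, a.e. nonnegative $v\in\mathrm H^1((-1,1),d\nu_d)$ with $\mathcal L v\in\mathrm L^2((-1,1),d\nu_d)$ (derivatives in the weak sense), $\int_{-1}^1 v\,d\nu_d=1$ and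 $\int_{-1}^1 z\,|v|^p\,d\nu_d=0$. Then, for every $p\in(2,2^\#)$, there is a constant $$\lambda\ \ge\ d+\frac{(d-1)^2}{d\,(d+2)}\,(2^\#-p)\,(\lambda^\star-d)$$ such that every $f\in\mathrm H^1((-1,1),d\nu_d)$ with $\int_{-1}^1 z\,|f|^p\,d\nu_d=0$ belongs to $\mathrm L^p((-1,1),d\nu_d)$ and satisfies $$\int_{-1}^1|f'|^2\,\nu\,d\nu_d+\frac{\lambda}{p-2}\,\|f\|_2^2\ \ge\ \frac{\lambda}{p-2}\,\|f\|_p^2 .$$ Moreover, $\lambda^\star\le2\,(d+1)$. -/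

import Mathlib

open MeasureTheory Set
open scoped ContDiff

noncomputable section

namespace Ultraspherical

/-- The weight `ν(z) = 1 - z²`. -/
def nu (z : ℝ) : ℝ := 1 - z ^ 2

/-- The normalization constant `Z_d = √π Γ(d/2) / Γ((d+1)/2)`. -/
def Z (d : ℕ) : ℝ :=
  Real.sqrt Real.pi * Real.Gamma ((d : ℝ) / 2) / Real.Gamma (((d : ℝ) + 1) / 2)

/-- The probability measure `dν_d = Z_d⁻¹ (1 - z²)^(d/2 - 1) dz` on `(-1, 1)`. -/
def nuMeasure (d : ℕ) : Measure ℝ :=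
  (volume.restrict (Ioo (-1 : ℝ) 1)).withDensity
    (fun z => ENNReal.ofReal ((Z d)⁻¹ * nu z ^ ((d : ℝ) / 2 - 1)))

/-- The norm `‖f‖_q = (∫ |f|^q dν_d)^(1/q)`, for `f ∈ L^q(dν_d)`. -/
def lqNorm (d : ℕ) (q : ℝ) (f : ℝ → ℝ) : ℝ :=
  (∫ z, |f z| ^ q ∂(nuMeasure d)) ^ (1 / q)

/-- `g` is the weak (distributional) derivative of `f` on the open interval `(-1, 1)`. -/
structure HasWeakDeriv (f g : ℝ → ℝ) : Prop where
  locInt : LocallyIntegrableOn f (Ioo (-1 : ℝ) 1) volume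
  locInt_deriv : LocallyIntegrableOn g (Ioo (-1 : ℝ) 1) volume
  integral_eq : ∀ φ : ℝ → ℝ, ContDiff ℝ ∞ φ → HasCompactSupport φ →
    tsupport φ ⊆ Ioo (-1 : ℝ) 1 →
    ∫ z in Ioo (-1 : ℝ) 1, f z * deriv φ z = -∫ z in Ioo (-1 : ℝ) 1, g z * φ z

/-- `f` belongs to `H¹((-1,1), dν_d)` with weak derivative `f'`: the form domain of the
ultraspherical operator, that is, `∫ |f|² dν_d` and the Dirichlet energy `∫ |f'|² ν dν_d` are
finite. -/
structure MemH1 (d : ℕ) (f f' : ℝ → ℝ) : Prop where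
  memL2 : MemLp f 2 (nuMeasure d)
  weakDeriv : HasWeakDeriv f f'
  energy : Integrable (fun z => f' z ^ 2 * nu z) (nuMeasure d)

/-- The ultraspherical operator `𝓛 f = (1 - z²) f'' - d z f'`, in terms of the first two (weak)
derivatives of `f`. -/
def ultraOp (d : ℕ) (f' f'' : ℝ → ℝ) (z : ℝ) : ℝ := nu z * f'' z - d * z * f' z

/-- The functions over which the infimum `λ⋆` is taken: `v ∈ H¹((-1,1), dν_d)`, `v ≥ 0` a.e.,
`∫ v dν_d = 1`, `∫ z |v|^p dν_d = 0`. The last two fields say that the quotient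
`∫ (𝓛 v)² dν_d / ∫ |v'|² ν dν_d` is meaningful and finite: `𝓛 v ∈ L²(dν_d)` (otherwise the
numerator is `+∞`), and `v` is not constant (otherwise the quotient is `0 / 0`). -/
structure Admissible (d : ℕ) (p : ℝ) (v v' v'' : ℝ → ℝ) : Prop where
  memH1 : MemH1 d v v'
  weakDeriv₂ : HasWeakDeriv v' v''
  nonneg : ∀ᵐ z ∂(nuMeasure d), 0 ≤ v z
  mean : ∫ z, v z ∂(nuMeasure d) = 1
  memLp : MemLp v (ENNReal.ofReal p) (nuMeasure d)
  balanced : ∫ z, z * |v z| ^ p ∂(nuMeasure d) = 0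
  memL2_op : MemLp (ultraOp d v' v'') 2 (nuMeasure d)
  energy_pos : 0 < ∫ z, v' z ^ 2 * nu z ∂(nuMeasure d)

/-- The constant `λ⋆`, the infimum of `∫ (𝓛 v)² dν_d / ∫ |v'|² ν dν_d`. -/
def lambdaStar (d : ℕ) (p : ℝ) : ℝ :=
  sInf {r : ℝ | ∃ v v' v'' : ℝ → ℝ, Admissible d p v v' v'' ∧
    r = (∫ z, ultraOp d v' v'' z ^ 2 ∂(nuMeasure d)) /
      (∫ z, v' z ^ 2 * nu z ∂(nuMeasure d))}

/-- The exponent `2^# = (2 d² + 1) / (d - 1)²`, for `d ≥ 2`. -/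
def twoSharp (d : ℕ) : ℝ := (2 * (d : ℝ) ^ 2 + 1) / ((d : ℝ) - 1) ^ 2

end Ultraspherical

end

/-! The proof is a carré du champ argument along the heat flow. Let `u` solve `∂ₜu = 𝓛u` and put `f
= u^(1/p)`, so that `∂ₜf = 𝓛f + (p-1) ν f'²/f`. The flow preserves `∫ u = ‖f‖_p^p` and the balance
condition `∫ z u = 0`, because `z` is an eigenfunction of `𝓛`. With `κ = λ/(p-2)`, the functional `∫
f'² ν + κ ∫ f²` has time derivative `-2 (∫ (𝓛f)² + (p-1)(ν f'²/f) 𝓛f - λ ∫ f'² ν)`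
(`dissipation_nonpos`). It is therefore nonincreasing as soon as the bracket is nonnegative, and its
limit as `t → ∞`, where `u` becomes constant, is `κ ‖f‖_p²`.

The bracket is handled by `flowConst_mul_le`. After integrations by parts, `∫ (𝓛f)² + (p-1)(ν f'²/f)
𝓛f` equals `(1-θ) ∫ (𝓛f)² + θ d ∫ f'² ν` plus the integral of a nonnegative square. The balance
condition persists in time, so `∫ (𝓛f)² ≥ λ⋆ ∫ f'² ν` at every time (`lambdaStar_mul_le`), and the
admissible constant is `(1-θ) λ⋆ + θ d`, which is `flowConst`. Its sign plays no role.

No parabolic theory is needed: a polynomial is a finite sum of eigenpolynomials of `𝓛`, its heat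
flow is explicit, and positivity is kept by a minimum principle (`le_eval_heatFlow`). This gives the
inequality for `q^(1/p)` with `q` a positive balanced polynomial (`interpolation_polynomial`), then
for positive balanced `u` of class `C¹` by Weierstrass approximation
(`interpolation_of_hasDerivAt`). A function of `H¹` is a.e. a primitive of its weak derivative; a
pointwise bound by a fixed `L^p` function (`exists_embedding_weight`) and the density of polynomials
in energy then yield the general case (`MemH1.interpolation`). The bound on `λ⋆` comes from the
second eigenfunction shifted by a constant. -/

noncomputable section

namespace Ultraspherical

open Polynomial Filter Topology

variable {d : ℕ}

/-! ### The measure, its total mass and integration by parts -/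

/-- The density of `nuMeasure d` with respect to Lebesgue measure on `(-1, 1)`. -/
def weight (d : ℕ) (z : ℝ) : ℝ := (Z d)⁻¹ * nu z ^ ((d : ℝ) / 2 - 1)

lemma nu_nonneg {z : ℝ} (hz : z ∈ Icc (-1 : ℝ) 1) : 0 ≤ nu z := by
  unfold nu; nlinarith [hz.1, hz.2]

lemma nu_pos {z : ℝ} (hz : z ∈ Ioo (-1 : ℝ) 1) : 0 < nu z := by
  unfold nu; nlinarith [hz.1, hz.2]

lemma nu_le_one (z : ℝ) : nu z ≤ 1 := by
  unfold nu; nlinarith [sq_nonneg z]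

lemma continuous_nu : Continuous nu := by unfold nu; fun_prop

lemma hasDerivAt_nu (z : ℝ) : HasDerivAt nu (-2 * z) z := by
  unfold nu
  convert! ((hasDerivAt_id z).pow 2).const_sub 1 using 1
  simp


lemma Z_pos (hd : 2 ≤ d) : 0 < Z d := by
  have h : (0 : ℝ) < d := by positivity
  unfold Z
  have := Real.Gamma_pos_of_pos (half_pos h)
  have := Real.Gamma_pos_of_pos (by positivity : 0 < ((d : ℝ) + 1) / 2)
  positivity

lemma half_sub_one_nonneg (hd : 2 ≤ d) : 0 ≤ (d : ℝ) / 2 - 1 := by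
  have : (2 : ℝ) ≤ d := by exact_mod_cast hd
  linarith

lemma continuous_weight (hd : 2 ≤ d) : Continuous (weight d) :=
  continuous_const.mul (continuous_nu.rpow_const fun _ => Or.inr (half_sub_one_nonneg hd))

lemma weight_nonneg (hd : 2 ≤ d) {z : ℝ} (hz : z ∈ Icc (-1 : ℝ) 1) : 0 ≤ weight d z :=
  mul_nonneg (inv_nonneg.2 (Z_pos hd).le) (Real.rpow_nonneg (nu_nonneg hz) _)

lemma weight_pos (hd : 2 ≤ d) {z : ℝ} (hz : z ∈ Ioo (-1 : ℝ) 1) : 0 < weight d z :=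
  mul_pos (inv_pos.2 (Z_pos hd)) (Real.rpow_pos_of_pos (nu_pos hz) _)

lemma integral_nuMeasure (hd : 2 ≤ d) (g : ℝ → ℝ) :
    ∫ z, g z ∂(nuMeasure d) = ∫ z in (-1 : ℝ)..1, g z * weight d z := by
  unfold nuMeasure
  rw [integral_withDensity_eq_integral_toReal_smul₀
    (by exact (continuous_weight hd).measurable.ennreal_ofReal.aemeasurable)
    (by simp), intervalIntegral.integral_of_le (by norm_num), integral_Ioc_eq_integral_Ioo]
  refine setIntegral_congr_fun measurableSet_Ioo fun z hz => ?_
  have := weight_nonneg hd (Ioo_subset_Icc_self hz)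
  change (ENNReal.ofReal (weight d z)).toReal * g z = _
  rw [ENNReal.toReal_ofReal this, mul_comm]

lemma integrable_nuMeasure_iff (hd : 2 ≤ d) {g : ℝ → ℝ} :
    Integrable g (nuMeasure d) ↔ IntegrableOn (fun z => g z * weight d z) (Ioo (-1) 1) := by
  unfold nuMeasure
  rw [integrable_withDensity_iff
    (by exact (continuous_weight hd).measurable.ennreal_ofReal) (by simp)]
  refine integrable_congr ?_
  filter_upwards [ae_restrict_mem measurableSet_Ioo] with z hz
  have := weight_nonneg hd (Ioo_subset_Icc_self hz)
  change _ * (ENNReal.ofReal (weight d z)).toReal = _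
  rw [ENNReal.toReal_ofReal this]

lemma nuMeasure_absolutelyContinuous : nuMeasure d ≪ volume.restrict (Ioo (-1 : ℝ) 1) :=
  withDensity_absolutelyContinuous _ _

lemma ae_mem_Ioo : ∀ᵐ z ∂(nuMeasure d), z ∈ Ioo (-1 : ℝ) 1 :=
  nuMeasure_absolutelyContinuous.ae_le (ae_restrict_mem measurableSet_Ioo)

lemma ae_mem_Icc : ∀ᵐ z ∂(nuMeasure d), z ∈ Icc (-1 : ℝ) 1 :=
  ae_mem_Ioo.mono fun _ hz => Ioo_subset_Icc_self hz

/-- The substitution `z = 2x - 1` turns the integral into `2 · 4^(s-1) B(s, s)`, and Legendre's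
duplication formula simplifies the gamma factors. -/
lemma integral_rpow_nu {s : ℝ} (hs : 0 < s) :
    ∫ z in (-1 : ℝ)..1, nu z ^ (s - 1) =
      Real.sqrt Real.pi * Real.Gamma s / Real.Gamma (s + 1 / 2) := by
  have hbeta : ∫ x in (0 : ℝ)..1, x ^ (s - 1) * (1 - x) ^ (s - 1) = ProbabilityTheory.beta s s := by
    rw [ProbabilityTheory.beta_eq_betaIntegralReal s s hs hs, Complex.betaIntegral]
    rw [intervalIntegral.integral_of_le zero_le_one, intervalIntegral.integral_of_le zero_le_one]
    rw [← Complex.ofReal_re (∫ x in Ioc (0 : ℝ) 1, x ^ (s - 1) * (1 - x) ^ (s - 1))]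
    congr 1
    rw [← integral_complex_ofReal]
    refine setIntegral_congr_fun measurableSet_Ioc fun x hx => ?_
    push_cast
    rw [Complex.ofReal_cpow hx.1.le, Complex.ofReal_cpow (by linarith [hx.2])]
    push_cast
    rfl
  have hsub := intervalIntegral.integral_comp_mul_sub (a := (0 : ℝ)) (b := 1)
    (fun z => nu z ^ (s - 1)) (c := 2) (by norm_num) 1
  have e : ∫ x in (0 : ℝ)..1, nu (2 * x - 1) ^ (s - 1) =
      4 ^ (s - 1) * ∫ x in (0 : ℝ)..1, x ^ (s - 1) * (1 - x) ^ (s - 1) := by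
    rw [← intervalIntegral.integral_const_mul]
    refine intervalIntegral.integral_congr fun x hx => ?_
    rw [uIcc_of_le zero_le_one] at hx
    have h1 : 0 ≤ 1 - x := by linarith [hx.2]
    rw [← Real.mul_rpow hx.1 h1, ← Real.mul_rpow (by norm_num) (mul_nonneg hx.1 h1)]
    congr 1
    unfold nu; ring
  norm_num at hsub
  rw [e, hbeta, ProbabilityTheory.beta] at hsub
  have dup := Real.Gamma_mul_Gamma_add_half s
  have hG := Real.Gamma_pos_of_pos hs
  have hG' := Real.Gamma_pos_of_pos (by linarith : 0 < s + 1 / 2)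
  have hG2 := Real.Gamma_pos_of_pos (by linarith : 0 < s + s)
  rw [← two_mul] at hsub hG2
  have h4 : (4 : ℝ) ^ (s - 1) * 2 * (2 : ℝ) ^ (1 - 2 * s) = 1 := by
    have h : (4 : ℝ) ^ (s - 1) = 2 ^ (2 * (s - 1)) := by
      rw [Real.rpow_mul (by norm_num)]; norm_num
    rw [h, ← Real.rpow_add_one (by norm_num), ← Real.rpow_add (by norm_num)]
    ring_nf
    simp
  rw [eq_div_iff hG'.ne']
  have : (∫ x in (-1 : ℝ)..1, nu x ^ (s - 1)) =
      2 * (4 ^ (s - 1) * (Real.Gamma s * Real.Gamma s / Real.Gamma (2 * s))) := by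
    linarith
  rw [this]
  generalize Real.Gamma (s + 1 / 2) = G at *
  field_simp
  linear_combination (2 * (4 : ℝ) ^ (s - 1)) * dup + Real.Gamma (2 * s) * √Real.pi * h4

lemma integral_weight (hd : 2 ≤ d) : ∫ z in (-1 : ℝ)..1, weight d z = 1 := by
  unfold weight
  rw [intervalIntegral.integral_const_mul, integral_rpow_nu (by positivity), ← add_div]
  exact inv_mul_cancel₀ (Z_pos hd).ne'

lemma isProbabilityMeasure (hd : 2 ≤ d) : IsProbabilityMeasure (nuMeasure d) := by
  have h1 : nuMeasure d univ = ∫⁻ z in Ioo (-1 : ℝ) 1, ENNReal.ofReal (weight d z) := by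
    unfold nuMeasure
    rw [withDensity_apply _ MeasurableSet.univ, Measure.restrict_univ]
    rfl
  have hint : IntegrableOn (weight d) (Ioo (-1) 1) :=
    ((continuous_weight hd).integrableOn_Icc).mono_set Ioo_subset_Icc_self
  refine ⟨?_⟩
  rw [h1, ← ofReal_integral_eq_lintegral_ofReal hint, ← integral_Ioc_eq_integral_Ioo,
    ← intervalIntegral.integral_of_le (by norm_num), integral_weight hd, ENNReal.ofReal_one]
  filter_upwards [ae_restrict_mem measurableSet_Ioo] with z hz
  exact weight_nonneg hd (Ioo_subset_Icc_self hz)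

lemma aestronglyMeasurable_of_continuousOn {g : ℝ → ℝ} (hg : ContinuousOn g (Icc (-1) 1)) :
    AEStronglyMeasurable g (nuMeasure d) :=
  ((hg.mono Ioo_subset_Icc_self).aestronglyMeasurable measurableSet_Ioo).mono_ac
    nuMeasure_absolutelyContinuous

lemma memLp_of_continuousOn (hd : 2 ≤ d) {g : ℝ → ℝ} (hg : ContinuousOn g (Icc (-1) 1))
    (q : ENNReal) : MemLp g q (nuMeasure d) := by
  have := isProbabilityMeasure hd
  obtain ⟨C, hC⟩ := isCompact_Icc.exists_bound_of_continuousOn hg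
  exact MemLp.of_bound (aestronglyMeasurable_of_continuousOn hg) C
    (ae_mem_Icc.mono fun z hz => hC z hz)

lemma integrable_of_continuousOn (hd : 2 ≤ d) {g : ℝ → ℝ} (hg : ContinuousOn g (Icc (-1) 1)) :
    Integrable g (nuMeasure d) :=
  memLp_one_iff_integrable.1 (memLp_of_continuousOn hd hg 1)

/-- Integration by parts: `∫ (a' b ν + a (ν b' - d z b)) dν_d = 0`. -/
lemma integral_parts (hd : 2 ≤ d) {a a' b b' : ℝ → ℝ}
    (ha : ∀ z ∈ Icc (-1 : ℝ) 1, HasDerivAt a (a' z) z)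
    (hb : ∀ z ∈ Icc (-1 : ℝ) 1, HasDerivAt b (b' z) z)
    (ha' : ContinuousOn a' (Icc (-1) 1)) (hb' : ContinuousOn b' (Icc (-1) 1)) :
    ∫ z, (a' z * b z * nu z + a z * (nu z * b' z - d * z * b z)) ∂(nuMeasure d) = 0 := by
  have hac : ContinuousOn a (Icc (-1) 1) := fun z hz => (ha z hz).continuousAt.continuousWithinAt
  have hbc : ContinuousOn b (Icc (-1) 1) := fun z hz => (hb z hz).continuousAt.continuousWithinAt
  have hd0 : (0 : ℝ) < d / 2 := by positivity
  rw [integral_nuMeasure hd]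
  have hnu := continuous_nu.continuousOn (s := Icc (-1 : ℝ) 1)
  have hcont : ContinuousOn (fun z => (a' z * b z * nu z + a z * (nu z * b' z - d * z * b z))
      * weight d z) (Icc (-1) 1) := by
    have := (continuous_weight hd).continuousOn (s := Icc (-1 : ℝ) 1)
    fun_prop
  -- The integrand is the derivative of `a b ν · weight = Z⁻¹ a b ν^(d/2)`, which vanishes at both
  -- endpoints because `d/2 > 0`; no boundary condition on `a`, `b` is needed.
  rw [intervalIntegral.integral_eq_sub_of_hasDerivAt_of_le
    (f := fun z => (Z d)⁻¹ * (a z * b z * nu z ^ ((d : ℝ) / 2))) (by norm_num)]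
  · simp [nu, Real.zero_rpow hd0.ne']
  · exact continuousOn_const.mul ((hac.mul hbc).mul
      (continuous_nu.rpow_const fun _ => Or.inr hd0.le).continuousOn)
  · intro z hz
    have hz' := Ioo_subset_Icc_self hz
    have hn := nu_pos hz
    have h1 := (hasDerivAt_nu z).rpow_const (p := (d : ℝ) / 2) (Or.inl hn.ne')
    convert! (((ha z hz').mul (hb z hz')).mul h1).const_mul (Z d)⁻¹ using 1
    have h2 : nu z ^ ((d : ℝ) / 2) = nu z * nu z ^ ((d : ℝ) / 2 - 1) := by
      rw [Real.rpow_sub_one hn.ne']; field_simp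
    simp only [weight, Pi.mul_apply, h2]
    ring
  · exact (hcont.mono (by rw [uIcc_of_le (by norm_num)])).intervalIntegrable

/-! ### Classical functions as competitors for `λ⋆` -/

lemma continuousOn_of_hasDerivAt {f f' : ℝ → ℝ} {s : Set ℝ}
    (hf : ∀ z ∈ s, HasDerivAt f (f' z) z) : ContinuousOn f s :=
  fun z hz => (hf z hz).continuousAt.continuousWithinAt

lemma hasWeakDeriv_of_hasDerivAt {f f' : ℝ → ℝ}
    (hf : ∀ z ∈ Icc (-1 : ℝ) 1, HasDerivAt f (f' z) z) (hf' : ContinuousOn f' (Icc (-1) 1)) :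
    HasWeakDeriv f f' where
  locInt := ((continuousOn_of_hasDerivAt hf).mono Ioo_subset_Icc_self).locallyIntegrableOn
    measurableSet_Ioo
  locInt_deriv := (hf'.mono Ioo_subset_Icc_self).locallyIntegrableOn measurableSet_Ioo
  integral_eq φ hφ _ hsupp := by
    have hfc := continuousOn_of_hasDerivAt hf
    have hφd : ∀ z, HasDerivAt φ (deriv φ z) z := fun z =>
      (hφ.differentiable (by simp) z).hasDerivAt
    have hφ'c : Continuous (deriv φ) := hφ.continuous_deriv (by simp)
    have h0 : ∀ z, z ∉ Ioo (-1 : ℝ) 1 → φ z = 0 := fun z hz =>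
      image_eq_zero_of_notMem_tsupport fun h => hz (hsupp h)
    have hc1 : ContinuousOn (fun z => f z * deriv φ z) (Icc (-1) 1) := hfc.mul hφ'c.continuousOn
    have hc2 : ContinuousOn (fun z => f' z * φ z) (Icc (-1) 1) :=
      hf'.mul hφ.continuous.continuousOn
    have key : ∫ z in (-1 : ℝ)..1, (f' z * φ z + f z * deriv φ z) = 0 := by
      rw [intervalIntegral.integral_eq_sub_of_hasDerivAt (f := fun z => f z * φ z)]
      · simp [h0 1 (by simp), h0 (-1) (by simp)]
      · intro z hz
        rw [uIcc_of_le (by norm_num)] at hz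
        exact (hf z hz).mul (hφd z)
      · refine ContinuousOn.intervalIntegrable ?_
        rw [uIcc_of_le (by norm_num)]
        exact hc2.add hc1
    rw [intervalIntegral.integral_of_le (by norm_num), integral_Ioc_eq_integral_Ioo,
      integral_add (hc2.integrableOn_Icc.mono_set Ioo_subset_Icc_self)
      (hc1.integrableOn_Icc.mono_set Ioo_subset_Icc_self)] at key
    linarith

/-- `λ⋆ ∫ |f'|² ν dν_d ≤ ∫ (𝓛 f)² dν_d` for positive balanced functions of class `C²`. -/
lemma lambdaStar_mul_le (hd : 2 ≤ d) {p : ℝ} {f f' f'' : ℝ → ℝ}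
    (hf : ∀ z ∈ Icc (-1 : ℝ) 1, HasDerivAt f (f' z) z)
    (hf' : ∀ z ∈ Icc (-1 : ℝ) 1, HasDerivAt f' (f'' z) z)
    (hf'' : ContinuousOn f'' (Icc (-1) 1)) (hpos : ∀ z ∈ Icc (-1 : ℝ) 1, 0 < f z)
    (hbal : ∫ z, z * f z ^ p ∂(nuMeasure d) = 0) :
    lambdaStar d p * ∫ z, f' z ^ 2 * nu z ∂(nuMeasure d) ≤
      ∫ z, ultraOp d f' f'' z ^ 2 ∂(nuMeasure d) := by
  have := isProbabilityMeasure hd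
  have hfc := continuousOn_of_hasDerivAt hf
  have hf'c := continuousOn_of_hasDerivAt hf'
  have hnu := continuous_nu.continuousOn (s := Icc (-1 : ℝ) 1)
  have hE : 0 ≤ ∫ z, f' z ^ 2 * nu z ∂(nuMeasure d) := integral_nonneg_of_ae <|
    ae_mem_Icc.mono fun z hz => mul_nonneg (sq_nonneg _) (nu_nonneg hz)
  have hN : 0 ≤ ∫ z, ultraOp d f' f'' z ^ 2 ∂(nuMeasure d) :=
    integral_nonneg fun z => sq_nonneg _
  -- With zero energy `f` is not an admissible competitor, but the inequality is trivial.
  rcases hE.eq_or_lt with hE0 | hE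
  · rw [← hE0, mul_zero]; exact hN
  have hI : 0 < ∫ z, f z ∂(nuMeasure d) := by
    rw [integral_pos_iff_support_of_nonneg_ae (ae_mem_Icc.mono fun z hz => (hpos z hz).le)
      (integrable_of_continuousOn hd hfc)]
    have : Function.support f =ᵐ[nuMeasure d] univ := by
      filter_upwards [ae_mem_Icc] with z hz
      exact eq_true (hpos z hz).ne'
    rw [measure_congr this]
    simp
  set I := ∫ z, f z ∂(nuMeasure d)
  have hop : ∀ z, ultraOp d (fun z => I⁻¹ * f' z) (fun z => I⁻¹ * f'' z) z =
      I⁻¹ * ultraOp d f' f'' z := fun z => by unfold ultraOp; ring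
  have hopc : ContinuousOn (ultraOp d f' f'') (Icc (-1) 1) := by
    unfold ultraOp; fun_prop
  -- Dividing by the mean `I` preserves positivity and balance, and does not change the quotient.
  have hadm : Admissible d p (fun z => I⁻¹ * f z) (fun z => I⁻¹ * f' z)
      (fun z => I⁻¹ * f'' z) := by
    refine ⟨⟨memLp_of_continuousOn hd (by fun_prop) _, hasWeakDeriv_of_hasDerivAt
      (fun z hz => (hf z hz).const_mul _) (by fun_prop),
      integrable_of_continuousOn hd (by fun_prop)⟩, hasWeakDeriv_of_hasDerivAt
      (fun z hz => (hf' z hz).const_mul _) (by fun_prop), ?_, ?_,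
      memLp_of_continuousOn hd (by fun_prop) _, ?_, ?_, ?_⟩
    · exact ae_mem_Icc.mono fun z hz => mul_nonneg (inv_nonneg.2 hI.le) (hpos z hz).le
    · rw [integral_const_mul]; exact inv_mul_cancel₀ hI.ne'
    · rw [← mul_zero (I⁻¹ ^ p), ← hbal, ← integral_const_mul]
      refine integral_congr_ae (ae_mem_Icc.mono fun z hz => ?_)
      have h1 := inv_nonneg.2 hI.le
      simp only
      rw [abs_of_nonneg (mul_nonneg h1 (hpos z hz).le), Real.mul_rpow h1 (hpos z hz).le]
      ring
    · refine memLp_of_continuousOn hd ?_ _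
      simp only [funext hop]
      fun_prop
    · have : ∀ z, (I⁻¹ * f' z) ^ 2 * nu z = I⁻¹ ^ 2 * (f' z ^ 2 * nu z) := fun z => by ring
      simp only [this]
      rw [integral_const_mul]
      positivity
  have hle : lambdaStar d p ≤ (∫ z, ultraOp d f' f'' z ^ 2 ∂(nuMeasure d)) /
      (∫ z, f' z ^ 2 * nu z ∂(nuMeasure d)) := by
    refine csInf_le ⟨0, ?_⟩ ⟨_, _, _, hadm, ?_⟩
    · rintro r ⟨v, v', v'', hv, rfl⟩
      exact div_nonneg (integral_nonneg fun z => sq_nonneg _) hv.energy_pos.le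
    · have h1 : ∀ z, (I⁻¹ * f' z) ^ 2 * nu z = I⁻¹ ^ 2 * (f' z ^ 2 * nu z) := fun z => by ring
      simp only [hop, mul_pow _ (ultraOp d f' f'' _), h1]
      rw [integral_const_mul, integral_const_mul, mul_div_mul_left]
      positivity
  rwa [le_div_iff₀ hE] at hle

/-! ### The carré du champ estimate -/

/-- The constant `d + (d-1)² / (d (d+2)) (2^# - p) (λ⋆ - d)`. -/
def flowConst (d : ℕ) (p : ℝ) : ℝ :=
  (d : ℝ) + ((d : ℝ) - 1) ^ 2 / ((d : ℝ) * ((d : ℝ) + 2)) * (twoSharp d - p) *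
    (lambdaStar d p - (d : ℝ))

/-- The carré du champ estimate along the heat flow. -/
lemma flowConst_mul_le (hd : 2 ≤ d) {p : ℝ} (hp : 2 < p) (hp' : p < twoSharp d)
    {f f' f'' : ℝ → ℝ}
    (hf : ∀ z ∈ Icc (-1 : ℝ) 1, HasDerivAt f (f' z) z)
    (hf' : ∀ z ∈ Icc (-1 : ℝ) 1, HasDerivAt f' (f'' z) z)
    (hf'' : ContinuousOn f'' (Icc (-1) 1)) (hpos : ∀ z ∈ Icc (-1 : ℝ) 1, 0 < f z)
    (hbal : ∫ z, z * f z ^ p ∂(nuMeasure d) = 0) :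
    flowConst d p * ∫ z, f' z ^ 2 * nu z ∂(nuMeasure d) ≤
      ∫ z, (ultraOp d f' f'' z ^ 2 + (p - 1) * (f' z ^ 2 * nu z / f z) * ultraOp d f' f'' z)
        ∂(nuMeasure d) := by
  have hd1 : (2 : ℝ) ≤ d := by exact_mod_cast hd
  have hfc := continuousOn_of_hasDerivAt hf
  have hf'c := continuousOn_of_hasDerivAt hf'
  have hne : ∀ z ∈ Icc (-1 : ℝ) 1, f z ≠ 0 := fun z hz => (hpos z hz).ne'
  have hne2 : ∀ z ∈ Icc (-1 : ℝ) 1, f z ^ 2 ≠ 0 := fun z hz => pow_ne_zero 2 (hne z hz)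
  have hnu := continuous_nu.continuousOn (s := Icc (-1 : ℝ) 1)
  have hLc : ContinuousOn (ultraOp d f' f'') (Icc (-1) 1) := by unfold ultraOp; fun_prop
  -- This `θ` makes the quadratic form in `ν f''` and `ν f'²/f` left after integration by parts a
  -- perfect square; `p < 2^#` is exactly `θ < 1`.
  set θ : ℝ := (p - 1) * (d - 1) ^ 2 / (d * (d + 2)) with hθ
  have hθ1 : 1 - θ = ((d : ℝ) - 1) ^ 2 / ((d : ℝ) * ((d : ℝ) + 2)) * (twoSharp d - p) := by
    have : (d : ℝ) - 1 ≠ 0 := by linarith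
    rw [hθ, twoSharp]; field_simp; ring
  have hθ2 : 0 ≤ 1 - θ := by
    rw [hθ1]; exact mul_nonneg (by positivity) (by linarith)
  -- The first term of `b` encodes `∫ (𝓛f)² = ∫ ν² f''² + d ∫ f'² ν`. The second has the coefficient
  -- `d/(d+2)` that cancels the term `z ν f'³/f`.
  have hparts := integral_parts hd (a := fun _ => 1) (a' := fun _ => 0)
    (b := fun z => θ * (-d * z * f' z ^ 2) + (p - 1) * (d / (d + 2)) * (nu z * f' z ^ 3 / f z))
    (b' := fun z => θ * (-d * f' z ^ 2 - 2 * d * z * f' z * f'' z) + (p - 1) * (d / (d + 2)) *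
      (-2 * z * f' z ^ 3 / f z + 3 * nu z * f' z ^ 2 * f'' z / f z - nu z * f' z ^ 4 / f z ^ 2))
    (fun z _ => hasDerivAt_const _ _) (fun z hz => by
      have h1 := (((hasDerivAt_id z).const_mul (-d : ℝ)).mul ((hf' z hz).pow 2)).const_mul θ
      have h2 := (((hasDerivAt_nu z).mul ((hf' z hz).pow 3)).div (hf z hz) (hne z hz)).const_mul
        ((p - 1) * (d / (d + 2)))
      convert! h1.add h2 using 1
      have := hne z hz
      simp only [Pi.mul_apply, Pi.pow_apply, id]
      field_simp
      push_cast
      ring) (by fun_prop) (by fun_prop (disch := assumption))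
  have hstar := lambdaStar_mul_le hd hf hf' hf'' hpos hbal
  have hi1 : Integrable (fun z => ultraOp d f' f'' z ^ 2) (nuMeasure d) :=
    integrable_of_continuousOn hd (by fun_prop)
  have hi2 : Integrable (fun z => f' z ^ 2 * nu z) (nuMeasure d) :=
    integrable_of_continuousOn hd (by fun_prop)
  have hlow : (1 - θ) * (∫ z, ultraOp d f' f'' z ^ 2 ∂(nuMeasure d)) +
      θ * d * (∫ z, f' z ^ 2 * nu z ∂(nuMeasure d)) ≤
      ∫ z, (ultraOp d f' f'' z ^ 2 + (p - 1) * (f' z ^ 2 * nu z / f z) * ultraOp d f' f'' z)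
        ∂(nuMeasure d) := by
    rw [← integral_const_mul, ← integral_const_mul, ← integral_add (hi1.const_mul _)
      (hi2.const_mul _), ← add_zero (∫ _, _ ∂_), ← hparts, ← integral_add]
    · refine integral_mono_ae ?_ ?_ (ae_mem_Icc.mono fun z hz => ?_)
      · refine integrable_of_continuousOn hd ?_
        fun_prop (disch := assumption)
      · refine integrable_of_continuousOn hd ?_
        fun_prop (disch := assumption)
      have hz0 := hne z hz
      -- The difference of the two integrands, corrected by the divergence `hparts`, is exactly this
      -- square.
      have hQ : 0 ≤ (p - 1) / (d * (d + 2)) *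
          ((d - 1) * (f'' z * nu z) - d * (f' z ^ 2 * nu z / f z)) ^ 2 :=
        mul_nonneg (div_nonneg (by linarith) (by positivity)) (sq_nonneg _)
      rw [← sub_nonneg]
      refine hQ.trans_eq ?_
      simp only [ultraOp, hθ]
      field_simp
      ring
    · refine integrable_of_continuousOn hd ?_
      fun_prop (disch := assumption)
    · refine integrable_of_continuousOn hd ?_
      fun_prop (disch := assumption)
  refine le_trans ?_ hlow
  have : flowConst d p = (1 - θ) * lambdaStar d p + θ * d := by
    rw [flowConst, ← hθ1]; ring
  rw [this, add_mul, mul_assoc]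
  gcongr

/-! ### Eigenpolynomials of `𝓛` -/

/-- The ultraspherical operator on polynomials. -/
def polyOp (d : ℕ) : ℝ[X] →ₗ[ℝ] ℝ[X] :=
  LinearMap.mulLeft ℝ (1 - X ^ 2) ∘ₗ derivative ∘ₗ derivative -
    LinearMap.mulLeft ℝ (C (d : ℝ) * X) ∘ₗ derivative

lemma polyOp_apply (q : ℝ[X]) :
    polyOp d q = (1 - X ^ 2) * derivative (derivative q) - C (d : ℝ) * X * derivative q := rfl

lemma eval_polyOp (q : ℝ[X]) (z : ℝ) : (polyOp d q).eval z =
    nu z * (derivative (derivative q)).eval z - d * z * (derivative q).eval z := by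
  simp [polyOp_apply, nu]

/-- The eigenvalues of `-𝓛`. -/
def eigenvalue (d k : ℕ) : ℝ := k * (k + d - 1)

lemma eigenvalue_strictMono (hd : 2 ≤ d) : StrictMono (eigenvalue d) := by
  intro a b hab
  have h1 : (a : ℝ) + 1 ≤ b := by exact_mod_cast hab
  have h2 : (2 : ℝ) ≤ d := by exact_mod_cast hd
  have h3 : (0 : ℝ) ≤ a := by positivity
  unfold eigenvalue
  nlinarith

/-- On monomials `𝓛` is triangular: `𝓛 X^(n+2) = (n+2)(n+1) X^n - λ_(n+2) X^(n+2)`. Since the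
eigenvalues are distinct, `X^(n+2)` becomes an eigenvector after subtracting a combination of the
components of `X^n`. The vanishing beyond `n` allows sums of different lengths to be added later. -/
lemma exists_eigen_decomposition_X_pow (hd : 2 ≤ d) (n : ℕ) : ∃ Q : ℕ → ℝ[X],
    (∀ k, polyOp d (Q k) = -eigenvalue d k • Q k) ∧ derivative (Q 0) = 0 ∧
      (∀ k, n < k → Q k = 0) ∧ X ^ n = ∑ k ∈ Finset.range (n + 1), Q k := by
  induction n using Nat.twoStepInduction with
  | zero =>
    refine ⟨fun k => if k = 0 then 1 else 0, fun k => ?_, by simp, fun k hk => ?_, by simp⟩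
    · by_cases hk : k = 0
      · simp [hk, polyOp_apply, eigenvalue]
      · simp [hk]
    · simp [hk.ne']
  | one =>
    refine ⟨fun k => if k = 1 then X else 0, fun k => ?_, by simp, fun k hk => ?_,
      by simp⟩
    · by_cases hk : k = 1
      · simp [hk, polyOp_apply, eigenvalue, smul_eq_C_mul]
      · simp [hk]
    · simp [hk.ne']
  | more n ih _ =>
    obtain ⟨Q, hQ, hQ0, hQn, hsum⟩ := ih
    -- Chosen so that `S = ∑ c_k Q_k` solves `𝓛S + λ_(n+2) S = (n+2)(n+1) X^n`.
    set c : ℕ → ℝ := fun k => (n + 2) * (n + 1) / (eigenvalue d (n + 2) - eigenvalue d k)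
    have hX : polyOp d (X ^ (n + 2)) =
        (((n : ℝ) + 2) * (n + 1)) • X ^ n - eigenvalue d (n + 2) • X ^ (n + 2) := by
      simp only [polyOp_apply, eigenvalue, smul_eq_C_mul]
      simp [show (C 2 : ℝ[X]) = 2 from rfl]
      ring
    set S : ℝ[X] := ∑ k ∈ Finset.range (n + 1), c k • Q k with hS
    have hLS : polyOp d S = -eigenvalue d (n + 2) • S + (((n : ℝ) + 2) * (n + 1)) • X ^ n := by
      rw [hsum, hS, map_sum, Finset.smul_sum, Finset.smul_sum, ← Finset.sum_add_distrib]
      refine Finset.sum_congr rfl fun k hk => ?_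
      have hk' : k < n + 2 := by have := Finset.mem_range.1 hk; omega
      have := sub_pos.2 (eigenvalue_strictMono hd hk')
      rw [map_smul, hQ, smul_smul, smul_smul, ← add_smul]
      congr 1
      simp only [c]
      field_simp
      ring
    refine ⟨fun k => if k = n + 2 then X ^ (n + 2) - S else c k • Q k, fun k => ?_, ?_,
      fun k hk => ?_, ?_⟩
    · by_cases hk : k = n + 2
      · simp only [hk, if_true]
        rw [map_sub, hX, hLS, smul_sub]
        module
      · simp only [hk, if_false]
        rw [map_smul, hQ, smul_comm]
    · simp [hQ0]
    · have h1 : k ≠ n + 2 := hk.ne'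
      simp [h1, hQn k (by omega)]
    · rw [Finset.sum_range_succ, Finset.sum_range_succ]
      have : ∑ k ∈ Finset.range (n + 1), (if k = n + 2 then X ^ (n + 2) - S else c k • Q k) = S :=
        Finset.sum_congr rfl fun k hk => by
          have : k ≠ n + 2 := by have := Finset.mem_range.1 hk; omega
          simp [this]
      rw [this]
      simp [hQn (n + 1) (by omega)]

lemma exists_eigen_decomposition (hd : 2 ≤ d) (q : ℝ[X]) : ∃ (n : ℕ) (Q : ℕ → ℝ[X]),
    (∀ k, polyOp d (Q k) = -eigenvalue d k • Q k) ∧ derivative (Q 0) = 0 ∧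
      q = ∑ k ∈ Finset.range (n + 1), Q k := by
  suffices h : ∃ (n : ℕ) (Q : ℕ → ℝ[X]),
      (∀ k, polyOp d (Q k) = -eigenvalue d k • Q k) ∧ derivative (Q 0) = 0 ∧
        (∀ k, n < k → Q k = 0) ∧ q = ∑ k ∈ Finset.range (n + 1), Q k by
    obtain ⟨n, Q, h1, h2, -, h3⟩ := h
    exact ⟨n, Q, h1, h2, h3⟩
  induction q using Polynomial.induction_on' with
  | add p q hp hq =>
    obtain ⟨n, Q, hQ, hQ0, hQn, hs⟩ := hp
    obtain ⟨m, R, hR, hR0, hRm, hs'⟩ := hq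
    refine ⟨max n m, Q + R, fun k => ?_, ?_, fun k hk => ?_, ?_⟩
    · simp only [Pi.add_apply, map_add, hQ, hR, smul_add]
    · simp [hQ0, hR0]
    · simp [hQn k (by omega), hRm k (by omega)]
    · simp only [Pi.add_apply, Finset.sum_add_distrib]
      rw [hs, hs']
      congr 1
      · refine Finset.sum_subset (by intro x; simp; omega) fun k _ hk => hQn k ?_
        simp at hk; omega
      · refine Finset.sum_subset (by intro x; simp; omega) fun k _ hk => hRm k ?_
        simp at hk; omega
  | monomial n a =>
    obtain ⟨Q, hQ, hQ0, hQn, hs⟩ := exists_eigen_decomposition_X_pow hd n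
    refine ⟨n, fun k => a • Q k, fun k => ?_, ?_, fun k hk => ?_, ?_⟩
    · rw [map_smul, hQ, smul_comm]
    · simp [hQ0]
    · simp [hQn k hk]
    · rw [← Finset.smul_sum, ← hs, ← C_mul_X_pow_eq_monomial, smul_eq_C_mul]

/-! ### The heat flow on polynomials -/

/-- The solution of the heat equation with initial datum `∑ Q k`, where `Q k` is an eigenfunction
for the `k`-th eigenvalue. -/
def heatFlow (d n : ℕ) (Q : ℕ → ℝ[X]) (t : ℝ) : ℝ[X] :=
  ∑ k ∈ Finset.range (n + 1), Real.exp (-eigenvalue d k * t) • Q k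

section HeatFlow
variable {n : ℕ} {Q : ℕ → ℝ[X]}

/-- The arbitrary linear map `T` lets one set of lemmas cover `u`, `u'`, `𝓛u` and `(𝓛u)'`. -/
lemma eval_map_heatFlow (T : ℝ[X] →ₗ[ℝ] ℝ[X]) (t z : ℝ) : (T (heatFlow d n Q t)).eval z =
    ∑ k ∈ Finset.range (n + 1), Real.exp (-eigenvalue d k * t) * (T (Q k)).eval z := by
  simp [heatFlow, map_sum, eval_finsetSum]

lemma hasDerivAt_heatFlow (hQ : ∀ k, polyOp d (Q k) = -eigenvalue d k • Q k)
    (T : ℝ[X] →ₗ[ℝ] ℝ[X]) (t z : ℝ) :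
    HasDerivAt (fun t => (T (heatFlow d n Q t)).eval z)
      ((T (polyOp d (heatFlow d n Q t))).eval z) t := by
  have := eval_map_heatFlow (d := d) (n := n) (Q := Q) (T ∘ₗ polyOp d) t z
  simp only [LinearMap.comp_apply] at this
  simp only [this, eval_map_heatFlow]
  refine HasDerivAt.fun_sum fun k _ => ?_
  rw [hQ, map_smul, eval_smul, smul_eq_mul, ← mul_assoc]
  have h := ((hasDerivAt_id t).const_mul (-eigenvalue d k)).exp.mul_const ((T (Q k)).eval z)
  simpa using h

lemma continuous_heatFlow (T : ℝ[X] →ₗ[ℝ] ℝ[X]) :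
    Continuous fun x : ℝ × ℝ => (T (heatFlow d n Q x.1)).eval x.2 := by
  simp only [eval_map_heatFlow]
  refine continuous_finsetSum _ fun k _ => ?_
  have := (T (Q k)).continuous
  fun_prop

lemma tendsto_heatFlow (hd : 2 ≤ d) (T : ℝ[X] →ₗ[ℝ] ℝ[X]) (z : ℝ) :
    Tendsto (fun t => (T (heatFlow d n Q t)).eval z) atTop (𝓝 ((T (Q 0)).eval z)) := by
  simp only [eval_map_heatFlow]
  have h : ∀ k ∈ Finset.range (n + 1), Tendsto
      (fun t => Real.exp (-eigenvalue d k * t) * (T (Q k)).eval z) atTop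
      (𝓝 (if k = 0 then (T (Q 0)).eval z else 0)) := by
    intro k _
    rcases Nat.eq_zero_or_pos k with rfl | hk
    · simp [eigenvalue]
    · have h0 : 0 < eigenvalue d k := by
        simpa [eigenvalue] using eigenvalue_strictMono hd hk
      rw [if_neg hk.ne', ← zero_mul ((T (Q k)).eval z)]
      refine Tendsto.mul_const _ (Real.tendsto_exp_atBot.comp ?_)
      exact tendsto_id.const_mul_atTop_of_neg (neg_lt_zero.2 h0)
  simpa using tendsto_finsetSum _ h

/-- All the exponentials are at most `1` for `t ≥ 0`. The uniformity in time is what dominated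
convergence needs as `t → ∞`. -/
lemma heatFlow_abs_le (hd : 2 ≤ d) (T : ℝ[X] →ₗ[ℝ] ℝ[X]) : ∃ M : ℝ, ∀ t, 0 ≤ t →
    ∀ z ∈ Icc (-1 : ℝ) 1, |(T (heatFlow d n Q t)).eval z| ≤ M := by
  have h : ∀ k, ∃ M : ℝ, ∀ z ∈ Icc (-1 : ℝ) 1, |(T (Q k)).eval z| ≤ M := fun k =>
    isCompact_Icc.exists_bound_of_continuousOn (T (Q k)).continuous.continuousOn
  choose M hM using h
  refine ⟨∑ k ∈ Finset.range (n + 1), M k, fun t ht z hz => ?_⟩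
  rw [eval_map_heatFlow]
  refine (Finset.abs_sum_le_sum_abs _ _).trans (Finset.sum_le_sum fun k _ => ?_)
  rw [abs_mul, abs_of_pos (Real.exp_pos _)]
  have h0 : 0 ≤ eigenvalue d k := by
    simpa [eigenvalue] using (eigenvalue_strictMono hd).monotone (Nat.zero_le k)
  have h1 : Real.exp (-eigenvalue d k * t) ≤ 1 := Real.exp_le_one_iff.2 (by nlinarith)
  exact (mul_le_of_le_one_left (abs_nonneg _) h1).trans (hM k z hz)

end HeatFlow

/-! ### The minimum principle -/

lemma deriv_nonpos_of_eventually_left {f : ℝ → ℝ} {D x : ℝ} (hf : HasDerivAt f D x)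
    (h : ∀ᶠ y in 𝓝[<] x, f x ≤ f y) : D ≤ 0 := by
  have h1 := (hasDerivWithinAt_iff_tendsto_slope' (s := Iio x) (by simp)).1 hf.hasDerivWithinAt
  refine le_of_tendsto h1 ?_
  filter_upwards [h, self_mem_nhdsWithin] with y hy hy'
  rw [slope_def_field]
  exact div_nonpos_of_nonneg_of_nonpos (sub_nonneg.2 hy) (sub_nonpos.2 (le_of_lt hy'))

lemma deriv_nonneg_of_eventually_right {f : ℝ → ℝ} {D x : ℝ} (hf : HasDerivAt f D x)
    (h : ∀ᶠ y in 𝓝[>] x, f x ≤ f y) : 0 ≤ D := by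
  have h1 := (hasDerivWithinAt_iff_tendsto_slope' (s := Ioi x) (by simp)).1 hf.hasDerivWithinAt
  refine ge_of_tendsto h1 ?_
  filter_upwards [h, self_mem_nhdsWithin] with y hy hy'
  rw [slope_def_field]
  exact div_nonneg (sub_nonneg.2 hy) (sub_nonneg.2 (le_of_lt hy'))

/-- Inside the interval `q' = 0` and `q'' ≥ 0`. At `±1` the second-order term disappears with `ν`,
and the drift `-d z q'` has the right sign because `q' ≥ 0` at a minimum at `-1` and `q' ≤ 0` at a
minimum at `1`. -/
lemma eval_polyOp_nonneg_of_isMinOn {q : ℝ[X]} {z : ℝ} (hz : z ∈ Icc (-1 : ℝ) 1)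
    (hmin : IsMinOn (fun x => q.eval x) (Icc (-1) 1) z) : 0 ≤ (polyOp d q).eval z := by
  rw [eval_polyOp]
  rcases eq_or_lt_of_le hz.1 with rfl | h1
  · have := deriv_nonneg_of_eventually_right (q.hasDerivAt (-1))
      (mem_of_superset (Ioc_mem_nhdsGT (by norm_num : (-1 : ℝ) < 1))
        fun y hy => hmin (Ioc_subset_Icc_self hy))
    have hd : (0 : ℝ) ≤ d := by positivity
    simp only [nu]
    nlinarith
  rcases eq_or_lt_of_le hz.2 with rfl | h2
  · have := deriv_nonpos_of_eventually_left (q.hasDerivAt 1)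
      (mem_of_superset (Ico_mem_nhdsLT (by norm_num : (-1 : ℝ) < 1))
        fun y hy => hmin (Ico_subset_Icc_self hy))
    have hd : (0 : ℝ) ≤ d := by positivity
    simp only [nu]
    nlinarith
  have hloc : IsLocalMin (fun x => q.eval x) z := hmin.isLocalMin (Icc_mem_nhds h1 h2)
  have hd1 : (derivative q).eval z = 0 := hloc.hasDerivAt_eq_zero (q.hasDerivAt z)
  have e1 : deriv (fun x => q.eval x) = fun x => (derivative q).eval x := by ext x; simp
  have e2 : deriv (deriv fun x => q.eval x) z = (derivative (derivative q)).eval z := by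
    rw [e1]; simp
  have hd2 : 0 ≤ (derivative (derivative q)).eval z := by
    -- If `q'' < 0`, the point is also a local maximum, so `q` is locally constant and `q'' = 0`.
    by_contra! hneg
    have hmax := isLocalMax_of_deriv_deriv_neg (by rw [e2]; exact hneg) (by rw [e1]; exact hd1)
      q.continuous.continuousAt
    have hconst : (fun x => q.eval x) =ᶠ[𝓝 z] fun _ => q.eval z := by
      filter_upwards [hmax, hloc] with x hx1 hx2 using le_antisymm hx1 hx2
    have := hconst.deriv.deriv_eq
    rw [e2] at this
    simp at this
    linarith
  rw [hd1]
  simpa using mul_nonneg (nu_nonneg hz) hd2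

/-- The minimum principle. -/
lemma le_eval_heatFlow {n : ℕ} {Q : ℕ → ℝ[X]}
    (hQ : ∀ k, polyOp d (Q k) = -eigenvalue d k • Q k) {m : ℝ}
    (hm : ∀ z ∈ Icc (-1 : ℝ) 1, m ≤ (heatFlow d n Q 0).eval z) {T : ℝ} (hT : 0 ≤ T) {z : ℝ}
    (hz : z ∈ Icc (-1 : ℝ) 1) : m ≤ (heatFlow d n Q T).eval z := by
  have hcont := continuous_heatFlow (d := d) (n := n) (Q := Q) LinearMap.id
  simp only [LinearMap.id_apply] at hcont
  refine le_of_forall_pos_le_add fun η hη => ?_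
  -- Adding `ε t` makes the principle strict: at a minimum with `t₀ > 0` the time derivative `𝓛u +
  -- ε` would be both positive and nonpositive. The `+ 1` covers `T = 0` and leaves `ε T ≤ η`.
  set ε := η / (T + 1)
  have hε : 0 < ε := by positivity
  obtain ⟨⟨t₀, z₀⟩, hmem, hmin⟩ := (isCompact_Icc.prod isCompact_Icc :
    IsCompact (Icc (0 : ℝ) T ×ˢ Icc (-1 : ℝ) 1)).exists_isMinOn
    ⟨(0, 0), by simp [hT]⟩
    (f := fun x => (heatFlow d n Q x.1).eval x.2 + ε * x.1) (by fun_prop)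
  obtain ⟨ht₀, hz₀⟩ := hmem
  simp only at ht₀ hz₀
  have hmin' : ∀ t ∈ Icc (0 : ℝ) T, ∀ x ∈ Icc (-1 : ℝ) 1,
      (heatFlow d n Q t₀).eval z₀ + ε * t₀ ≤ (heatFlow d n Q t).eval x + ε * t :=
    fun t ht x hx => hmin (show (t, x) ∈ _ from ⟨ht, hx⟩)
  have ht0 : t₀ = 0 := by
    by_contra hne
    have hpos : 0 < t₀ := lt_of_le_of_ne ht₀.1 (Ne.symm hne)
    have hL : 0 ≤ (polyOp d (heatFlow d n Q t₀)).eval z₀ :=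
      eval_polyOp_nonneg_of_isMinOn hz₀ fun x hx => by
        have := hmin' t₀ ht₀ x hx
        simpa using this
    have hD := (hasDerivAt_heatFlow (n := n) hQ LinearMap.id t₀ z₀).add
      ((hasDerivAt_id t₀).const_mul ε)
    have := deriv_nonpos_of_eventually_left hD (mem_of_superset (Ioo_mem_nhdsLT hpos)
      fun y hy => hmin' y ⟨hy.1.le, hy.2.le.trans ht₀.2⟩ z₀ hz₀)
    simp only [LinearMap.id_apply, mul_one] at this
    linarith
  have h1 := hmin' T ⟨hT, le_rfl⟩ z hz
  have h2 := hm z₀ hz₀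
  rw [ht0, mul_zero, add_zero] at h1
  have h3 : ε * T ≤ η := by
    rw [div_mul_eq_mul_div, div_le_iff₀ (by positivity)]
    nlinarith
  linarith

/-! ### Moments preserved by the flow -/

lemma integrable_eval (hd : 2 ≤ d) (q : ℝ[X]) : Integrable (fun z => q.eval z) (nuMeasure d) :=
  integrable_of_continuousOn hd q.continuous.continuousOn

lemma integral_polyOp (hd : 2 ≤ d) (q : ℝ[X]) :
    ∫ z, (polyOp d q).eval z ∂(nuMeasure d) = 0 := by
  rw [← integral_parts hd (a := fun _ => 1) (a' := fun _ => 0) (fun z _ => hasDerivAt_const _ _)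
    (fun z _ => (derivative q).hasDerivAt z) (by fun_prop)
    (derivative (derivative q)).continuous.continuousOn]
  simp only [eval_polyOp, zero_mul, zero_add, one_mul]

/-- Self-adjointness of `𝓛` together with `𝓛 z = -d z`, obtained from two integrations by parts. -/
lemma integral_mul_polyOp (hd : 2 ≤ d) (q : ℝ[X]) :
    ∫ z, z * (polyOp d q).eval z ∂(nuMeasure d) = -d * ∫ z, z * q.eval z ∂(nuMeasure d) := by
  have h1 := integral_parts hd (a := fun z => z) (a' := fun _ => 1) (fun z _ => hasDerivAt_id z)
    (fun z _ => (derivative q).hasDerivAt z) (by fun_prop)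
    (derivative (derivative q)).continuous.continuousOn
  have h2 := integral_parts hd (b := fun z => 1) (b' := fun _ => 0)
    (fun z _ => q.hasDerivAt z) (fun z _ => hasDerivAt_const _ _)
    (derivative q).continuous.continuousOn (by fun_prop)
  have c0 := q.continuous
  have c1 := (derivative q).continuous
  have c2 := (derivative (derivative q)).continuous
  have c3 := continuous_nu
  have i1 : Integrable (fun z => 1 * (derivative q).eval z * nu z + z *
      (nu z * (derivative (derivative q)).eval z - d * z * (derivative q).eval z))
      (nuMeasure d) := integrable_of_continuousOn hd (by fun_prop)
  have i2 : Integrable (fun z => (derivative q).eval z * 1 * nu z + q.eval z *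
      (nu z * 0 - d * z * 1)) (nuMeasure d) := integrable_of_continuousOn hd (by fun_prop)
  have h3 := integral_sub i1 i2
  rw [h1, h2, sub_zero] at h3
  have i3 : Integrable (fun z => z * (polyOp d q).eval z) (nuMeasure d) :=
    integrable_of_continuousOn hd
      (by have := (polyOp d q).continuous; fun_prop)
  have i4 : Integrable (fun z => d * (z * q.eval z)) (nuMeasure d) :=
    integrable_of_continuousOn hd (by fun_prop)
  rw [neg_mul, eq_neg_iff_add_eq_zero, ← integral_const_mul, ← integral_add i3 i4, ← h3]
  congr 1
  ext z
  rw [eval_polyOp]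
  ring

/-- Conservation of mass: `∫ 𝓛 Q_k = 0` forces `∫ Q_k = 0` when the eigenvalue is nonzero. -/
lemma integral_heatFlow (hd : 2 ≤ d) {n : ℕ} {Q : ℕ → ℝ[X]}
    (hQ : ∀ k, polyOp d (Q k) = -eigenvalue d k • Q k) (t : ℝ) :
    ∫ z, (heatFlow d n Q t).eval z ∂(nuMeasure d) = ∫ z, (Q 0).eval z ∂(nuMeasure d) := by
  have h := fun z => eval_map_heatFlow (d := d) (n := n) (Q := Q) LinearMap.id t z
  simp only [LinearMap.id_apply] at h
  simp only [h]
  rw [integral_finsetSum _ fun k _ => (integrable_eval hd (Q k)).const_mul _,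
    Finset.sum_eq_single 0]
  · simp [eigenvalue]
  · intro k _ hk
    have h1 := integral_polyOp hd (Q k)
    have h0 : 0 < eigenvalue d k := by
      simpa [eigenvalue] using eigenvalue_strictMono hd (Nat.pos_of_ne_zero hk)
    simp only [hQ, eval_smul, smul_eq_mul] at h1
    rw [integral_const_mul] at h1 ⊢
    rw [(mul_eq_zero.1 h1).resolve_left (by simpa using h0.ne'), mul_zero]
  · simp

/-- The function `z` is orthogonal to every eigenpolynomial whose eigenvalue is not `d`, so only the
mode `k = 1` contributes and the moment is its initial value times `e^(-dt)`. -/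
lemma integral_mul_heatFlow (hd : 2 ≤ d) {n : ℕ} {Q : ℕ → ℝ[X]}
    (hQ : ∀ k, polyOp d (Q k) = -eigenvalue d k • Q k)
    (h0 : ∫ z, z * (heatFlow d n Q 0).eval z ∂(nuMeasure d) = 0) (t : ℝ) :
    ∫ z, z * (heatFlow d n Q t).eval z ∂(nuMeasure d) = 0 := by
  have hi : ∀ k, Integrable (fun z => z * (Q k).eval z) (nuMeasure d) := fun k =>
    integrable_of_continuousOn hd (by have := (Q k).continuous; fun_prop)
  have hk : ∀ k, k ≠ 1 → ∫ z, z * (Q k).eval z ∂(nuMeasure d) = 0 := by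
    intro k hk
    have h1 := integral_mul_polyOp hd (Q k)
    simp only [hQ, eval_smul, smul_eq_mul, mul_left_comm _ (-eigenvalue d k)] at h1
    rw [integral_const_mul] at h1
    have h2 : eigenvalue d k ≠ d := by
      have : eigenvalue d 1 = d := by simp [eigenvalue]
      rw [← this]
      exact fun h => hk ((eigenvalue_strictMono hd).injective h)
    have h3 : (eigenvalue d k - d) * ∫ z, z * (Q k).eval z ∂(nuMeasure d) = 0 := by linarith
    exact (mul_eq_zero.1 h3).resolve_left (sub_ne_zero.2 h2)
  have hsum : ∀ t, ∫ z, z * (heatFlow d n Q t).eval z ∂(nuMeasure d) =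
      ∑ k ∈ Finset.range (n + 1), Real.exp (-eigenvalue d k * t) *
        ∫ z, z * (Q k).eval z ∂(nuMeasure d) := by
    intro t
    have h := fun z => eval_map_heatFlow (d := d) (n := n) (Q := Q) LinearMap.id t z
    simp only [LinearMap.id_apply] at h
    simp only [h, Finset.mul_sum, mul_left_comm _ (Real.exp _)]
    rw [integral_finsetSum _ fun k _ => (hi k).const_mul _]
    simp only [integral_const_mul]
  have hsing : ∀ t, ∫ z, z * (heatFlow d n Q t).eval z ∂(nuMeasure d) =
      if 1 ∈ Finset.range (n + 1) then
        Real.exp (-eigenvalue d 1 * t) * ∫ z, z * (Q 1).eval z ∂(nuMeasure d) else 0 := by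
    intro t
    rw [hsum]
    split_ifs with h
    · exact Finset.sum_eq_single_of_mem 1 h fun k _ hk1 => by rw [hk k hk1, mul_zero]
    · exact Finset.sum_eq_zero fun k hk' => by
        rw [hk k (fun h1 => h (h1 ▸ hk')), mul_zero]
  rw [hsing] at h0 ⊢
  split_ifs at h0 ⊢ with h
  · simp only [mul_zero, Real.exp_zero, one_mul] at h0
    rw [h0, mul_zero]
  · rfl

/-! ### Dissipation along the flow -/

/-- The integrand `|f'|² ν + κ f²` at `z`, for `f = u^(1/p)`, in terms of `a = u z` and
`b = u' z`. -/
def flowDensity (p κ a b z : ℝ) : ℝ := (1 / p * a ^ (1 / p - 1) * b) ^ 2 * nu z +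
  κ * (a ^ (1 / p)) ^ 2

lemma hasDerivAt_rpow_inv {p : ℝ} {u : ℝ → ℝ} {u' x : ℝ} (hu : HasDerivAt u u' x)
    (hpos : 0 < u x) :
    HasDerivAt (fun y => u y ^ (1 / p)) (1 / p * u x ^ (1 / p - 1) * u') x := by
  convert! hu.rpow_const (p := 1 / p) (Or.inl hpos.ne') using 1
  ring

/-- Used in the space variable with `v = u'` (giving `f''`) and with `v = 𝓛u` (giving `(∂ₜf)'`), and
in the time variable to differentiate `f'`. -/
lemma hasDerivAt_rpow_inv_deriv {p : ℝ} {u v : ℝ → ℝ} {u' v' x : ℝ} (hu : HasDerivAt u u' x)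
    (hv : HasDerivAt v v' x) (hpos : 0 < u x) :
    HasDerivAt (fun y => 1 / p * u y ^ (1 / p - 1) * v y)
      (1 / p * ((1 / p - 1) * u x ^ (1 / p - 2) * u' * v x + u x ^ (1 / p - 1) * v')) x := by
  convert! ((hu.rpow_const (p := 1 / p - 1) (Or.inl hpos.ne')).const_mul (1 / p)).mul hv using 1
  rw [show 1 / p - 1 - 1 = 1 / p - 2 by ring]
  ring

lemma continuousOn_flowDensity (p κ : ℝ) {α : Type*} [TopologicalSpace α]
    {S : Set α} {a b z : α → ℝ} (ha : ContinuousOn a S) (hb : ContinuousOn b S)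
    (hz : ContinuousOn z S) (hpos : ∀ x ∈ S, 0 < a x) :
    ContinuousOn (fun x => flowDensity p κ (a x) (b x) (z x)) S := by
  have h1 : ContinuousOn (fun x => a x ^ (1 / p - 1)) S :=
    ha.rpow_const fun x hx => Or.inl (hpos x hx).ne'
  have h2 : ContinuousOn (fun x => a x ^ (1 / p)) S :=
    ha.rpow_const fun x hx => Or.inl (hpos x hx).ne'
  unfold flowDensity nu
  fun_prop

lemma tendsto_integral_of_bound (hd : 2 ≤ d) {ι : Type*} {l : Filter ι} [l.IsCountablyGenerated]
    {G : ι → ℝ → ℝ} {g : ℝ → ℝ} {M : ℝ}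
    (hG : ∀ᶠ i in l, ContinuousOn (G i) (Icc (-1) 1))
    (hM : ∀ᶠ i in l, ∀ z ∈ Icc (-1 : ℝ) 1, |G i z| ≤ M)
    (hlim : ∀ z ∈ Icc (-1 : ℝ) 1, Tendsto (fun i => G i z) l (𝓝 (g z))) :
    Tendsto (fun i => ∫ z, G i z ∂(nuMeasure d)) l (𝓝 (∫ z, g z ∂(nuMeasure d))) := by
  have := isProbabilityMeasure hd
  refine tendsto_integral_filter_of_dominated_convergence (fun _ => M)
    (hG.mono fun i hi => aestronglyMeasurable_of_continuousOn hi)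
    (hM.mono fun i hi => ae_mem_Icc.mono fun z hz => hi z hz) (integrable_const _)
    (ae_mem_Icc.mono fun z hz => hlim z hz)

/-- Away from `a = 0` the density is continuous, hence bounded on the compact box containing all the
values. This serves continuity in time, the limit `t → ∞` and the polynomial approximation. -/
lemma tendsto_integral_flowDensity (hd : 2 ≤ d) (p κ : ℝ) {ι : Type*} {l : Filter ι}
    [l.IsCountablyGenerated] {U V : ι → ℝ → ℝ} {u v : ℝ → ℝ} {m M : ℝ} (hm : 0 < m)
    (hU : ∀ᶠ i in l, ContinuousOn (U i) (Icc (-1) 1))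
    (hV : ∀ᶠ i in l, ContinuousOn (V i) (Icc (-1) 1))
    (hUb : ∀ᶠ i in l, ∀ z ∈ Icc (-1 : ℝ) 1, U i z ∈ Icc m M)
    (hVb : ∀ᶠ i in l, ∀ z ∈ Icc (-1 : ℝ) 1, V i z ∈ Icc (-M) M)
    (hUu : ∀ z ∈ Icc (-1 : ℝ) 1, Tendsto (fun i => U i z) l (𝓝 (u z)))
    (hVv : ∀ z ∈ Icc (-1 : ℝ) 1, Tendsto (fun i => V i z) l (𝓝 (v z)))
    (hu : ∀ z ∈ Icc (-1 : ℝ) 1, 0 < u z) :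
    Tendsto (fun i => ∫ z, flowDensity p κ (U i z) (V i z) z ∂(nuMeasure d)) l
      (𝓝 (∫ z, flowDensity p κ (u z) (v z) z ∂(nuMeasure d))) := by
  obtain ⟨B, hB⟩ := (isCompact_Icc.prod (isCompact_Icc.prod isCompact_Icc) :
    IsCompact (Icc m M ×ˢ (Icc (-M) M ×ˢ Icc (-1 : ℝ) 1))).exists_bound_of_continuousOn
    (continuousOn_flowDensity p κ (a := fun x : ℝ × ℝ × ℝ => x.1)
      (b := fun x => x.2.1) (z := fun x => x.2.2) (by fun_prop) (by fun_prop) (by fun_prop)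
      fun x hx => hm.trans_le hx.1.1)
  refine tendsto_integral_of_bound hd (M := B) ?_ ?_ fun z hz => ?_
  · filter_upwards [hU, hV, hUb] with i h1 h2 h3
    exact continuousOn_flowDensity p κ h1 h2 continuousOn_id
      fun z hz => hm.trans_le (h3 z hz).1
  · filter_upwards [hUb, hVb] with i h1 h2 z hz
    exact hB (U i z, V i z, z) ⟨h1 z hz, h2 z hz, hz⟩
  · have h1 := (hUu z hz).rpow_const (p := 1 / p - 1) (Or.inl (hu z hz).ne')
    have h2 := (hUu z hz).rpow_const (p := 1 / p) (Or.inl (hu z hz).ne')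
    exact (((((h1.const_mul (1 / p)).mul (hVv z hz)).pow 2).mul_const (nu z))).add
      ((h2.pow 2).const_mul κ)

lemma hasDerivAt_integral_of_continuousOn (hd : 2 ≤ d) {G G' : ℝ → ℝ → ℝ} {a b t : ℝ}
    (ht : t ∈ Ioo a b) (hG : ∀ s ∈ Ioo a b, ContinuousOn (G s) (Icc (-1) 1))
    (hG' : ContinuousOn (fun x : ℝ × ℝ => G' x.1 x.2) (Icc a b ×ˢ Icc (-1) 1))
    (hderiv : ∀ s ∈ Ioo a b, ∀ z ∈ Icc (-1 : ℝ) 1, HasDerivAt (fun s => G s z) (G' s z) s) :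
    HasDerivAt (fun s => ∫ z, G s z ∂(nuMeasure d)) (∫ z, G' t z ∂(nuMeasure d)) t := by
  have := isProbabilityMeasure hd
  obtain ⟨B, hB⟩ := (isCompact_Icc.prod isCompact_Icc).exists_bound_of_continuousOn hG'
  have hnhds := Ioo_mem_nhds ht.1 ht.2
  refine (hasDerivAt_integral_of_dominated_loc_of_deriv_le (bound := fun _ => B) hnhds ?_
    (integrable_of_continuousOn hd (hG t ht)) (aestronglyMeasurable_of_continuousOn ?_) ?_
    (integrable_const _) ?_).2
  · filter_upwards [hnhds] with s hs using aestronglyMeasurable_of_continuousOn (hG s hs)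
  · exact hG'.comp (by fun_prop : ContinuousOn (fun z : ℝ => (t, z)) _)
      fun z hz => ⟨Ioo_subset_Icc_self ht, hz⟩
  · filter_upwards [ae_mem_Icc] with z hz s hs
    exact hB (s, z) ⟨Ioo_subset_Icc_self hs, hz⟩
  · filter_upwards [ae_mem_Icc] with z hz s hs using hderiv s hs z hz

/-- The dissipation of the functional along the heat flow, for a positive balanced `u` of class
`C³`, where `w = 𝓛 u`. -/
lemma dissipation_nonpos (hd : 2 ≤ d) {p : ℝ} (hp : 2 < p) (hp' : p < twoSharp d)
    {u u' u'' w w' : ℝ → ℝ}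
    (hu : ∀ z ∈ Icc (-1 : ℝ) 1, HasDerivAt u (u' z) z)
    (hu' : ∀ z ∈ Icc (-1 : ℝ) 1, HasDerivAt u' (u'' z) z)
    (hu'' : ContinuousOn u'' (Icc (-1) 1))
    (hw : ∀ z ∈ Icc (-1 : ℝ) 1, HasDerivAt w (w' z) z) (hw' : ContinuousOn w' (Icc (-1) 1))
    (huw : ∀ z, w z = nu z * u'' z - d * z * u' z)
    (hpos : ∀ z ∈ Icc (-1 : ℝ) 1, 0 < u z)
    (hbal : ∫ z, z * u z ∂(nuMeasure d) = 0) :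
    ∫ z, (2 * (1 / p * u z ^ (1 / p - 1) * u' z) *
      (1 / p * ((1 / p - 1) * u z ^ (1 / p - 2) * w z * u' z + u z ^ (1 / p - 1) * w' z)) * nu z +
      flowConst d p / (p - 2) * (2 * u z ^ (1 / p) * (1 / p * u z ^ (1 / p - 1) * w z)))
        ∂(nuMeasure d) ≤ 0 := by
  have hp0 : p ≠ 0 := by linarith
  have hp2 : p - 2 ≠ 0 := by linarith
  set f : ℝ → ℝ := fun z => u z ^ (1 / p) with hf_def
  set f' : ℝ → ℝ := fun z => 1 / p * u z ^ (1 / p - 1) * u' z with hf'_def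
  set f'' : ℝ → ℝ := fun z => 1 / p * ((1 / p - 1) * u z ^ (1 / p - 2) * u' z * u' z +
    u z ^ (1 / p - 1) * u'' z) with hf''_def
  set g : ℝ → ℝ := fun z => 1 / p * u z ^ (1 / p - 1) * w z with hg_def
  set g' : ℝ → ℝ := fun z => 1 / p * ((1 / p - 1) * u z ^ (1 / p - 2) * u' z * w z +
    u z ^ (1 / p - 1) * w' z) with hg'_def
  have hf : ∀ z ∈ Icc (-1 : ℝ) 1, HasDerivAt f (f' z) z := fun z hz =>
    hasDerivAt_rpow_inv (hu z hz) (hpos z hz)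
  have hf' : ∀ z ∈ Icc (-1 : ℝ) 1, HasDerivAt f' (f'' z) z := fun z hz =>
    hasDerivAt_rpow_inv_deriv (hu z hz) (hu' z hz) (hpos z hz)
  have hg : ∀ z ∈ Icc (-1 : ℝ) 1, HasDerivAt g (g' z) z := fun z hz =>
    hasDerivAt_rpow_inv_deriv (hu z hz) (hw z hz) (hpos z hz)
  have huc := continuousOn_of_hasDerivAt hu
  have hu'c := continuousOn_of_hasDerivAt hu'
  have hwc := continuousOn_of_hasDerivAt hw
  have hr : ∀ r : ℝ, ContinuousOn (fun z => u z ^ r) (Icc (-1) 1) := fun r =>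
    huc.rpow_const fun z hz => Or.inl (hpos z hz).ne'
  have hr1 := hr (1 / p - 1)
  have hr2 := hr (1 / p - 2)
  have hf''c : ContinuousOn f'' (Icc (-1) 1) := by fun_prop
  have hg'c : ContinuousOn g' (Icc (-1) 1) := by fun_prop
  have hfc := continuousOn_of_hasDerivAt hf
  have hf'c := continuousOn_of_hasDerivAt hf'
  have hgc := continuousOn_of_hasDerivAt hg
  have hnu := continuous_nu.continuousOn (s := Icc (-1 : ℝ) 1)
  have hfpos : ∀ z ∈ Icc (-1 : ℝ) 1, 0 < f z := fun z hz => Real.rpow_pos_of_pos (hpos z hz) _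
  have hfne : ∀ z ∈ Icc (-1 : ℝ) 1, f z ≠ 0 := fun z hz => (hfpos z hz).ne'
  -- The evolution equation of `f`: the heat equation for `u = f^p` seen through the chain rule,
  -- with `g = ∂ₜf`.
  have hg_eq : ∀ z ∈ Icc (-1 : ℝ) 1,
      g z = ultraOp d f' f'' z + (p - 1) * (f' z ^ 2 * nu z / f z) := by
    intro z hz
    have hz0 := hpos z hz
    have hA := hfne z hz
    simp only [hg_def, hf'_def, hf''_def, hf_def, ultraOp, huw] at hA ⊢
    have r1 := Real.rpow_sub_one hz0.ne' (1 / p)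
    have r2 : u z ^ (1 / p - 2) = u z ^ (1 / p) / u z / u z := by
      rw [← r1, ← Real.rpow_sub_one hz0.ne']; ring_nf
    rw [r2, r1]
    generalize u z ^ (1 / p) = A at *
    have := hz0.ne'
    field_simp
    ring
  have hLc : ContinuousOn (ultraOp d f' f'') (Icc (-1) 1) := by unfold ultraOp; fun_prop
  have hmain := flowConst_mul_le hd hp hp' hf hf' hf''c hfpos (by
    rw [← hbal]
    refine integral_congr_ae (ae_mem_Icc.mono fun z hz => ?_)
    simp only [hf_def]
    rw [← Real.rpow_mul (hpos z hz).le, one_div_mul_cancel hp0, Real.rpow_one])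
  have h1 := integral_parts hd hg hf' hg'c hf''c
  have h2 := integral_parts hd hf hf' hf'c hf''c
  set κ := flowConst d p / (p - 2) with hκ
  have hκ' : flowConst d p = κ * (p - 2) := by rw [hκ]; field_simp
  -- The time derivative is rewritten as two divergences, which integrate to zero by `h1` and `h2`,
  -- plus `-2` times the quantity bounded below in `hmain` and `2κ(p-2) = 2 flowConst` times the
  -- energy.
  have e1 : ∫ z, (2 * f' z * (1 / p * ((1 / p - 1) * u z ^ (1 / p - 2) * w z * u' z +
      u z ^ (1 / p - 1) * w' z)) * nu z + κ * (2 * f z * g z)) ∂(nuMeasure d) =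
      ∫ z, (2 * (g' z * f' z * nu z + g z * (nu z * f'' z - d * z * f' z)) +
      2 * κ * (f' z * f' z * nu z + f z * (nu z * f'' z - d * z * f' z)) +
      (-2) * (ultraOp d f' f'' z ^ 2 + (p - 1) * (f' z ^ 2 * nu z / f z) * ultraOp d f' f'' z) +
      2 * κ * (p - 2) * (f' z ^ 2 * nu z)) ∂(nuMeasure d) := by
    refine integral_congr_ae (ae_mem_Icc.mono fun z hz => ?_)
    have hA := hfne z hz
    have e2 : f z * g z = f z * ultraOp d f' f'' z + (p - 1) * (f' z ^ 2 * nu z) := by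
      rw [hg_eq z hz]; field_simp
    have e3 : 1 / p * ((1 / p - 1) * u z ^ (1 / p - 2) * w z * u' z +
      u z ^ (1 / p - 1) * w' z) = g' z := by simp only [hg'_def]; ring
    have e4 : nu z * f'' z - d * z * f' z = ultraOp d f' f'' z := rfl
    simp only
    rw [e3, e4]
    have e5 := hg_eq z hz
    linear_combination 2 * κ * e2 - 2 * ultraOp d f' f'' z * e5
  rw [e1, integral_add, integral_add, integral_add, integral_const_mul, integral_const_mul,
    integral_const_mul, integral_const_mul, h1, h2]
  · rw [hκ'] at hmain
    linarith
  all_goals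
    refine integrable_of_continuousOn hd ?_
    fun_prop (disch := assumption)

/-- The interpolation inequality for `f = q^(1/p)`, with `q` a positive balanced polynomial. -/
lemma interpolation_polynomial (hd : 2 ≤ d) {p : ℝ} (hp : 2 < p) (hp' : p < twoSharp d)
    (q : ℝ[X]) (hpos : ∀ z ∈ Icc (-1 : ℝ) 1, 0 < q.eval z)
    (hbal : ∫ z, z * q.eval z ∂(nuMeasure d) = 0) :
    flowConst d p / (p - 2) * ((∫ z, q.eval z ∂(nuMeasure d)) ^ (1 / p)) ^ 2 ≤
      ∫ z, flowDensity p (flowConst d p / (p - 2)) (q.eval z) ((derivative q).eval z) z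
        ∂(nuMeasure d) := by
  have := isProbabilityMeasure hd
  obtain ⟨n, Q, hQ, hQ0, hq⟩ := exists_eigen_decomposition hd q
  obtain ⟨z₀, hz₀, hz₀min⟩ := isCompact_Icc.exists_isMinOn ⟨(0 : ℝ), by simp⟩
    (q.continuous.continuousOn (s := Icc (-1 : ℝ) 1))
  set m := q.eval z₀
  have hm : 0 < m := hpos z₀ hz₀
  have hflow0 : heatFlow d n Q 0 = q := by simp [heatFlow, hq]
  set U : ℝ → ℝ → ℝ := fun t z => (heatFlow d n Q t).eval z with hU
  set V : ℝ → ℝ → ℝ := fun t z => (derivative (heatFlow d n Q t)).eval z with hV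
  set W : ℝ → ℝ → ℝ := fun t z => (polyOp d (heatFlow d n Q t)).eval z with hW
  set W' : ℝ → ℝ → ℝ := fun t z => (derivative (polyOp d (heatFlow d n Q t))).eval z with hW'
  have hmU : ∀ t, 0 ≤ t → ∀ z ∈ Icc (-1 : ℝ) 1, m ≤ U t z := fun t ht z hz =>
    le_eval_heatFlow hQ (by rw [hflow0]; exact fun z hz => hz₀min hz) ht hz
  obtain ⟨M₁, hM₁⟩ := heatFlow_abs_le (n := n) (Q := Q) hd LinearMap.id
  obtain ⟨M₂, hM₂⟩ := heatFlow_abs_le (n := n) (Q := Q) hd derivative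
  set M := max M₁ M₂
  have hUb : ∀ t, 0 ≤ t → ∀ z ∈ Icc (-1 : ℝ) 1, U t z ∈ Icc m M := fun t ht z hz =>
    ⟨hmU t ht z hz, (le_abs_self _).trans ((hM₁ t ht z hz).trans (le_max_left _ _))⟩
  have hVb : ∀ t, 0 ≤ t → ∀ z ∈ Icc (-1 : ℝ) 1, V t z ∈ Icc (-M) M := fun t ht z hz =>
    abs_le.1 ((hM₂ t ht z hz).trans (le_max_right _ _))
  have hUc : Continuous fun x : ℝ × ℝ => U x.1 x.2 := continuous_heatFlow LinearMap.id
  have hVc : Continuous fun x : ℝ × ℝ => V x.1 x.2 := continuous_heatFlow derivative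
  have hWc : Continuous fun x : ℝ × ℝ => W x.1 x.2 := continuous_heatFlow (polyOp d)
  have hW'c : Continuous fun x : ℝ × ℝ => W' x.1 x.2 :=
    continuous_heatFlow (derivative ∘ₗ polyOp d)
  have hUz : ∀ t, ContinuousOn (U t) (Icc (-1) 1) := fun t =>
    (heatFlow d n Q t).continuous.continuousOn
  have hVz : ∀ t, ContinuousOn (V t) (Icc (-1) 1) := fun t =>
    (derivative (heatFlow d n Q t)).continuous.continuousOn
  set κ := flowConst d p / (p - 2) with hκ
  set Φ : ℝ → ℝ := fun t => ∫ z, flowDensity p κ (U t z) (V t z) z ∂(nuMeasure d) with hΦ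
  have hderiv : ∀ t, 0 < t → ∃ D ≤ 0, HasDerivAt Φ D t := by
    intro t ht
    refine ⟨_, dissipation_nonpos hd hp hp' (u := U t) (u' := V t)
      (u'' := fun z => (derivative (derivative (heatFlow d n Q t))).eval z) (w := W t) (w' := W' t)
      (fun z _ => (heatFlow d n Q t).hasDerivAt z)
      (fun z _ => (derivative (heatFlow d n Q t)).hasDerivAt z)
      (derivative (derivative (heatFlow d n Q t))).continuous.continuousOn
      (fun z _ => (polyOp d (heatFlow d n Q t)).hasDerivAt z)
      (derivative (polyOp d (heatFlow d n Q t))).continuous.continuousOn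
      (fun z => eval_polyOp _ z) (fun z hz => hm.trans_le (hmU t ht.le z hz))
      (integral_mul_heatFlow hd hQ (by rw [hflow0]; exact hbal) t), ?_⟩
    -- The window `[t/2, t+1]` stays in positive times, where the minimum principle keeps `U ≥ m`.
    have hposI : ∀ x ∈ Icc (t / 2) (t + 1) ×ˢ Icc (-1 : ℝ) 1, 0 < U x.1 x.2 := fun x hx =>
      hm.trans_le (hmU _ (by linarith [hx.1.1]) _ hx.2)
    refine hasDerivAt_integral_of_continuousOn hd (a := t / 2) (b := t + 1)
      (G := fun t z => flowDensity p κ (U t z) (V t z) z)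
      (G' := fun t z => 2 * (1 / p * U t z ^ (1 / p - 1) * V t z) *
        (1 / p * ((1 / p - 1) * U t z ^ (1 / p - 2) * W t z * V t z +
        U t z ^ (1 / p - 1) * W' t z)) * nu z +
        κ * (2 * U t z ^ (1 / p) * (1 / p * U t z ^ (1 / p - 1) * W t z)))
      ⟨by linarith, by linarith⟩ ?_ ?_ ?_
    · intro s hs
      exact continuousOn_flowDensity p κ (hUz s) (hVz s) continuousOn_id
        fun z hz => hm.trans_le (hmU s (by linarith [hs.1]) z hz)
    · have hr : ∀ r : ℝ, ContinuousOn (fun x : ℝ × ℝ => U x.1 x.2 ^ r)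
          (Icc (t / 2) (t + 1) ×ˢ Icc (-1 : ℝ) 1) := fun r =>
        hUc.continuousOn.rpow_const fun x hx => Or.inl (hposI x hx).ne'
      have h1 := hr (1 / p - 1)
      have h2 := hr (1 / p - 2)
      have h3 := hr (1 / p)
      have := continuous_nu
      fun_prop
    · intro s hs z hz
      have hs0 : 0 < U s z := hm.trans_le (hmU s (by linarith [hs.1]) z hz)
      have h1 : HasDerivAt (fun s => U s z) (W s z) s := hasDerivAt_heatFlow hQ LinearMap.id s z
      have h2 : HasDerivAt (fun s => V s z) (W' s z) s := hasDerivAt_heatFlow hQ derivative s z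
      have h3 := hasDerivAt_rpow_inv (p := p) h1 hs0
      have h4 := hasDerivAt_rpow_inv_deriv (p := p) h1 h2 hs0
      convert! ((h4.pow 2).mul_const (nu z)).add ((h3.pow 2).const_mul κ) using 1
      simp only [pow_one, Nat.cast_ofNat, Nat.add_one_sub_one]
  -- The derivative is controlled for `t > 0` only; continuity carries the monotonicity to the
  -- initial time.
  have hcont : ContinuousOn Φ (Ici 0) := by
    intro t ht
    refine tendsto_integral_flowDensity hd p κ (M := M) hm (Eventually.of_forall hUz)
      (Eventually.of_forall hVz) (eventually_mem_nhdsWithin.mono fun s hs => hUb s hs)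
      (eventually_mem_nhdsWithin.mono fun s hs => hVb s hs) (fun z _ => ?_) (fun z _ => ?_)
      fun z hz => hm.trans_le (hmU t ht z hz)
    · exact ((hUc.comp (by fun_prop : Continuous fun s : ℝ => (s, z))).tendsto t).mono_left
        nhdsWithin_le_nhds
    · exact ((hVc.comp (by fun_prop : Continuous fun s : ℝ => (s, z))).tendsto t).mono_left
        nhdsWithin_le_nhds
  have hanti : AntitoneOn Φ (Ici 0) := by
    refine antitoneOn_of_deriv_nonpos (convex_Ici 0) hcont (fun t ht => ?_) fun t ht => ?_
    · rw [interior_Ici] at ht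
      obtain ⟨D, -, hD⟩ := hderiv t ht
      exact hD.differentiableAt.differentiableWithinAt
    · rw [interior_Ici] at ht
      obtain ⟨D, hD0, hD⟩ := hderiv t ht
      rwa [hD.deriv]
  have hlimU : ∀ z, Tendsto (fun t => U t z) atTop (𝓝 ((Q 0).eval z)) := fun z =>
    tendsto_heatFlow hd LinearMap.id z
  have hlimV : ∀ z, Tendsto (fun t => V t z) atTop (𝓝 0) := fun z => by
    have := tendsto_heatFlow (n := n) (Q := Q) hd derivative z
    simpa [hQ0] using this
  have hlim : Tendsto Φ atTop (𝓝 (∫ z, flowDensity p κ ((Q 0).eval z) 0 z ∂(nuMeasure d))) := by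
    refine tendsto_integral_flowDensity hd p κ (M := M) hm (Eventually.of_forall hUz)
      (Eventually.of_forall hVz) ((eventually_ge_atTop 0).mono fun s hs => hUb s hs)
      ((eventually_ge_atTop 0).mono fun s hs => hVb s hs) (fun z _ => hlimU z)
      (fun z _ => hlimV z) fun z hz => ?_
    exact hm.trans_le (ge_of_tendsto (hlimU z)
      ((eventually_ge_atTop 0).mono fun s hs => hmU s hs z hz))
  have hle := le_of_tendsto hlim ((eventually_ge_atTop 0).mono fun t ht =>
    hanti (mem_Ici.2 le_rfl) (mem_Ici.2 ht) ht)
  have hΦ0 : Φ 0 = ∫ z, flowDensity p κ (q.eval z) ((derivative q).eval z) z ∂(nuMeasure d) := by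
    simp only [hΦ, hU, hV, hflow0]
  rw [hΦ0] at hle
  refine le_of_eq_of_le ?_ hle
  have hint := integral_heatFlow (n := n) hd hQ 0
  rw [hflow0] at hint
  -- `Q 0` is a constant, which by conservation of mass is `∫ q`; the limit of `Φ` is thus `κ (∫
  -- q)^(2/p)`.
  rw [eq_C_of_derivative_eq_zero hQ0] at hint ⊢
  rw [hint]
  simp [flowDensity]

/-! ### From polynomials to functions of class `C¹` -/

lemma exists_antiderivative (r : ℝ[X]) (c : ℝ) : ∃ R : ℝ[X], derivative R = r ∧ R.eval 0 = c := by
  suffices h : ∃ R : ℝ[X], derivative R = r by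
    obtain ⟨R, hR⟩ := h
    exact ⟨R + C (c - R.eval 0), by simp [hR], by simp⟩
  induction r using Polynomial.induction_on' with
  | add p q hp hq =>
    obtain ⟨P, rfl⟩ := hp
    obtain ⟨Q, rfl⟩ := hq
    exact ⟨P + Q, by simp⟩
  | monomial n a =>
    refine ⟨monomial (n + 1) (a / (n + 1)), ?_⟩
    rw [derivative_monomial]
    congr 1
    push_cast
    field_simp

/-- Read off from `∫ 𝓛(z²) = 0`, since `𝓛(z²) = 2 - 2(d+1) z²`. -/
lemma integral_sq (hd : 2 ≤ d) : ∫ z, z ^ 2 ∂(nuMeasure d) = 1 / (d + 1) := by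
  have := isProbabilityMeasure hd
  have h := integral_polyOp hd (X ^ 2)
  have e : ∀ z, (polyOp d (X ^ 2)).eval z = 2 - 2 * (d + 1) * z ^ 2 := fun z => by
    simp [eval_polyOp, nu]; ring
  simp only [e] at h
  rw [integral_sub (integrable_const _) ((integrable_of_continuousOn hd (by fun_prop)).const_mul _),
    integral_const_mul] at h
  simp at h
  field_simp
  linarith

/-- The interpolation inequality for `f = u^(1/p)`, with `u` positive, balanced and of class
`C¹`. -/
lemma interpolation_of_hasDerivAt (hd : 2 ≤ d) {p : ℝ} (hp : 2 < p) (hp' : p < twoSharp d)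
    {u u' : ℝ → ℝ} (hu : ∀ z ∈ Icc (-1 : ℝ) 1, HasDerivAt u (u' z) z)
    (hu' : ContinuousOn u' (Icc (-1) 1)) (hpos : ∀ z ∈ Icc (-1 : ℝ) 1, 0 < u z)
    (hbal : ∫ z, z * u z ∂(nuMeasure d) = 0) :
    flowConst d p / (p - 2) * ((∫ z, u z ∂(nuMeasure d)) ^ (1 / p)) ^ 2 ≤
      ∫ z, flowDensity p (flowConst d p / (p - 2)) (u z) (u' z) z ∂(nuMeasure d) := by
  have huc := continuousOn_of_hasDerivAt hu
  obtain ⟨z₀, hz₀, hz₀min⟩ := isCompact_Icc.exists_isMinOn ⟨(0 : ℝ), by simp⟩ huc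
  obtain ⟨M₁, hM₁⟩ := isCompact_Icc.exists_bound_of_continuousOn huc
  obtain ⟨M₂, hM₂⟩ := isCompact_Icc.exists_bound_of_continuousOn hu'
  set m := u z₀
  have hm : 0 < m := hpos z₀ hz₀
  set e : ℕ → ℝ := fun n => 1 / ((n : ℝ) + 1) with he
  have he0 : ∀ n, 0 < e n := fun n => Nat.one_div_pos_of_nat
  have helim : Tendsto e atTop (𝓝 0) := tendsto_one_div_add_atTop_nhds_zero_nat
  -- Weierstrass is applied to `u'`, and the approximation is integrated from `0`; since `|z| ≤ 1`
  -- the error on `u` is no larger.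
  have hex : ∀ n, ∃ g : ℝ[X], (∀ z ∈ Icc (-1 : ℝ) 1, |(derivative g).eval z - u' z| ≤ e n) ∧
      ∀ z ∈ Icc (-1 : ℝ) 1, |g.eval z - u z| ≤ e n := by
    intro n
    obtain ⟨r, hr⟩ := exists_polynomial_near_of_continuousOn (-1) 1 u' hu' (e n) (he0 n)
    obtain ⟨g, rfl, hg0⟩ := exists_antiderivative r (u 0)
    refine ⟨g, fun z hz => (hr z hz).le, fun z hz => ?_⟩
    have := (convex_Icc (-1 : ℝ) 1).norm_image_sub_le_of_norm_hasDerivWithin_le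
      (f := fun z => g.eval z - u z) (C := e n) (x := 0) (y := z)
      (fun x hx => ((g.hasDerivAt x).sub (hu x hx)).hasDerivWithinAt)
      (fun x hx => (hr x hx).le) (by simp) hz
    simp only [hg0, sub_self, sub_zero, Real.norm_eq_abs] at this
    exact this.trans (mul_le_of_le_one_right (he0 n).le (abs_le.2 hz))
  choose g hg' hg using hex
  have lim_of : ∀ {a : ℕ → ℝ} {b : ℝ}, (∀ n, |a n - b| ≤ e n) → Tendsto a atTop (𝓝 b) := by
    intro a b h
    rw [tendsto_iff_dist_tendsto_zero]
    exact squeeze_zero (fun _ => dist_nonneg) h helim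
  have he1 : ∀ n, e n ≤ 1 := fun n => by
    simp only [he]; rw [div_le_one (by positivity)]; linarith [(Nat.cast_nonneg n : (0 : ℝ) ≤ n)]
  -- Subtracting `δ z` restores the balance; the factor `d + 1` is `1 / ∫ z²`.
  set δ : ℕ → ℝ := fun n => (d + 1) * ∫ z, z * (g n).eval z ∂(nuMeasure d) with hδ
  have hδlim : Tendsto δ atTop (𝓝 0) := by
    have h : Tendsto (fun n => ∫ z, z * (g n).eval z ∂(nuMeasure d)) atTop
        (𝓝 (∫ z, z * u z ∂(nuMeasure d))) := by
      refine tendsto_integral_of_bound hd (M := M₁ + 1)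
        (Eventually.of_forall fun n => (by have := (g n).continuous; fun_prop))
        (Eventually.of_forall fun n z hz => ?_) fun z hz =>
        (lim_of fun n => hg n z hz).const_mul z
      rw [abs_mul]
      refine (mul_le_of_le_one_left (abs_nonneg _) (abs_le.2 hz)).trans ?_
      have h1 := hg n z hz
      have h2 := hM₁ z hz
      rw [Real.norm_eq_abs] at h2
      linarith [abs_sub_abs_le_abs_sub ((g n).eval z) (u z), he1 n]
    rw [hbal] at h
    simpa [hδ] using h.const_mul ((d : ℝ) + 1)
  set q : ℕ → ℝ[X] := fun n => g n - C (δ n) * X with hq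
  have hqe : ∀ n z, (q n).eval z = (g n).eval z - δ n * z := fun n z => by simp [hq]
  have hq'e : ∀ n z, (derivative (q n)).eval z = (derivative (g n)).eval z - δ n :=
    fun n z => by simp [hq]
  have hqbal : ∀ n, ∫ z, z * (q n).eval z ∂(nuMeasure d) = 0 := by
    intro n
    have h1 : ∀ z, z * (q n).eval z = z * (g n).eval z - δ n * z ^ 2 := fun z => by
      rw [hqe]; ring
    simp only [h1]
    rw [integral_sub (integrable_of_continuousOn hd (by have := (g n).continuous; fun_prop))
      ((integrable_of_continuousOn hd (by fun_prop)).const_mul _), integral_const_mul,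
      integral_sq hd]
    simp only [hδ]
    field_simp
    ring
  -- Two errors of at most `m/4` leave `q ≥ m/2`, so positivity is uniform.
  have hbound : ∀ᶠ n in atTop, e n ≤ m / 4 ∧ |δ n| ≤ m / 4 ∧ |δ n| ≤ 1 := by
    have h1 := helim.eventually (Iic_mem_nhds (by linarith : (0 : ℝ) < m / 4))
    have h2 := hδlim.abs.eventually (Iic_mem_nhds (by rw [abs_zero]; linarith : |(0 : ℝ)| < m / 4))
    have h3 := hδlim.abs.eventually (Iic_mem_nhds (by simp : |(0 : ℝ)| < 1))
    filter_upwards [h1, h2, h3] with n a b c using ⟨a, b, c⟩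
  have hδz : ∀ n, ∀ z ∈ Icc (-1 : ℝ) 1, |δ n * z| ≤ |δ n| := fun n z hz => by
    rw [abs_mul]; exact mul_le_of_le_one_right (abs_nonneg _) (abs_le.2 hz)
  set M := max M₁ M₂ + 2 with hM
  have hqU : ∀ᶠ n in atTop, ∀ z ∈ Icc (-1 : ℝ) 1, (q n).eval z ∈ Icc (m / 2) M := by
    filter_upwards [hbound] with n hn z hz
    have h1 := abs_le.1 (hg n z hz)
    have h2 := abs_le.1 (hδz n z hz)
    have h3 := abs_le.1 (hM₁ z hz)
    have h4 : m ≤ u z := hz₀min hz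
    have h5 := he1 n
    have h6 := le_max_left M₁ M₂
    rw [hqe]
    constructor <;> linarith
  have hqV : ∀ᶠ n in atTop, ∀ z ∈ Icc (-1 : ℝ) 1,
      (derivative (q n)).eval z ∈ Icc (-M) M := by
    filter_upwards [hbound] with n hn z hz
    have h1 := abs_le.1 (hg' n z hz)
    have h2 := abs_le.1 hn.2.2
    have h3 := abs_le.1 (hM₂ z hz)
    have h5 := he1 n
    have h6 := le_max_right M₁ M₂
    rw [hq'e]
    constructor <;> linarith
  have hlimU : ∀ z ∈ Icc (-1 : ℝ) 1, Tendsto (fun n => (q n).eval z) atTop (𝓝 (u z)) := by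
    intro z hz
    simp only [hqe]
    simpa using (lim_of fun n => hg n z hz).sub (hδlim.mul_const z)
  have hlimV : ∀ z ∈ Icc (-1 : ℝ) 1,
      Tendsto (fun n => (derivative (q n)).eval z) atTop (𝓝 (u' z)) := by
    intro z hz
    simp only [hq'e]
    simpa using (lim_of fun n => hg' n z hz).sub hδlim
  have lim1 := tendsto_integral_flowDensity hd p (flowConst d p / (p - 2)) (half_pos hm)
    (Eventually.of_forall fun n => (q n).continuous.continuousOn)
    (Eventually.of_forall fun n => (derivative (q n)).continuous.continuousOn) hqU hqV hlimU hlimV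
    hpos
  have lim2 : Tendsto (fun n => ∫ z, (q n).eval z ∂(nuMeasure d)) atTop
      (𝓝 (∫ z, u z ∂(nuMeasure d))) :=
    tendsto_integral_of_bound hd (M := M)
      (Eventually.of_forall fun n => (q n).continuous.continuousOn)
      (hqU.mono fun n hn z hz => abs_le.2 ⟨by linarith [(hn z hz).1, (hn z hz).2], (hn z hz).2⟩)
      hlimU
  have lim3 := ((lim2.rpow_const (p := 1 / p) (Or.inr (by positivity))).pow 2).const_mul
    (flowConst d p / (p - 2))
  refine le_of_tendsto_of_tendsto lim3 lim1 ?_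
  filter_upwards [hqU] with n hn
  exact interpolation_polynomial hd hp hp' (q n)
    (fun z hz => (half_pos hm).trans_le (hn z hz).1) (hqbal n)

/-! ### Weak derivatives and primitives -/

lemma exists_subset_Icc_of_isCompact {K : Set ℝ} (hK : IsCompact K) (hsub : K ⊆ Ioo (-1) 1) :
    ∃ r ∈ Ioo (0 : ℝ) 1, K ⊆ Icc (-r) r := by
  rcases K.eq_empty_or_nonempty with rfl | hne
  · exact ⟨1 / 2, by norm_num, by simp⟩
  obtain ⟨x, hx, hmax⟩ := hK.exists_isMaxOn hne continuous_abs.continuousOn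
  have hx1 : |x| < 1 := abs_lt.2 (hsub hx)
  refine ⟨(|x| + 1) / 2, ⟨by positivity, by linarith⟩, fun y hy => abs_le.1 ?_⟩
  have : |y| ≤ |x| := hmax hy
  linarith

lemma intervalIntegrable_of_locallyIntegrableOn {g : ℝ → ℝ}
    (hg : LocallyIntegrableOn g (Ioo (-1 : ℝ) 1)) {a b : ℝ} (ha : a ∈ Ioo (-1 : ℝ) 1)
    (hb : b ∈ Ioo (-1 : ℝ) 1) : IntervalIntegrable g volume a b :=
  intervalIntegrable_iff.2 ((hg.integrableOn_compact_subset
    (ordConnected_Ioo.uIcc_subset ha hb) isCompact_uIcc).mono_set uIoc_subset_uIcc)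

lemma zero_mem_Ioo : (0 : ℝ) ∈ Ioo (-1 : ℝ) 1 := by norm_num

lemma continuousOn_primitive {g : ℝ → ℝ} (hg : LocallyIntegrableOn g (Ioo (-1 : ℝ) 1)) :
    ContinuousOn (fun z => ∫ x in (0 : ℝ)..z, g x) (Ioo (-1) 1) := by
  intro z hz
  obtain ⟨r, hr, hzr⟩ := exists_subset_Icc_of_isCompact (isCompact_singleton (x := |z|))
    (by simpa using ⟨by linarith [abs_nonneg z], abs_lt.2 hz⟩)
  have hzr' : |z| ≤ r := (hzr rfl).2
  set s := (r + 1) / 2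
  have hs : r < s ∧ s < 1 := by constructor <;> simp only [s] <;> linarith [hr.2]
  have h := (intervalIntegral.continuousOn_primitive_interval'
    (intervalIntegrable_of_locallyIntegrableOn hg (a := -s) (b := s)
      ⟨by linarith, by linarith [hr.1]⟩ ⟨by linarith [hr.1], hs.2⟩)
    (a := 0) (by rw [uIcc_of_le (by linarith [hr.1])]; constructor <;> linarith [hr.1]))
  rw [uIcc_of_le (by linarith [hr.1])] at h
  have hz2 := abs_le.1 hzr'
  exact (h.continuousAt (Icc_mem_nhds (by linarith) (by linarith))).continuousWithinAt

lemma integral_Ioo_eq_of_support {g : ℝ → ℝ} {r : ℝ} (hr : r ∈ Ioo (0 : ℝ) 1)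
    (h : ∀ z, z ∉ Icc (-r) r → g z = 0) :
    ∫ z in Ioo (-1 : ℝ) 1, g z = ∫ z in (-r)..r, g z := by
  rw [intervalIntegral.integral_of_le (by linarith [hr.1]), ← integral_Icc_eq_integral_Ioc]
  exact setIntegral_eq_of_subset_of_forall_sdiff_eq_zero measurableSet_Ioo
    (fun z hz => ⟨by linarith [hz.1, hr.2], by linarith [hz.2, hr.2]⟩) fun z hz => h z hz.2

/-- The primitive of a locally integrable function satisfies the weak derivative identity. -/
lemma integral_primitive_mul_deriv {g φ : ℝ → ℝ} (hg : LocallyIntegrableOn g (Ioo (-1 : ℝ) 1))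
    (hφ : ContDiff ℝ ∞ φ) (hc : HasCompactSupport φ) (hsupp : tsupport φ ⊆ Ioo (-1 : ℝ) 1) :
    ∫ z in Ioo (-1 : ℝ) 1, (∫ x in (0 : ℝ)..z, g x) * deriv φ z =
      -∫ z in Ioo (-1 : ℝ) 1, g z * φ z := by
  obtain ⟨r, hr, hrs⟩ := exists_subset_Icc_of_isCompact hc hsupp
  -- On the slightly larger interval `[-s, s]` the boundary terms vanish, as `±s` lie outside the
  -- support of `φ`.
  set s := (r + 1) / 2 with hs_def
  have hs : r < s ∧ s < 1 := by constructor <;> linarith [hr.2]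
  have hs0 : 0 < s := hr.1.trans hs.1
  have hφ0 : ∀ z, z ∉ Icc (-r) r → φ z = 0 := fun z hz =>
    image_eq_zero_of_notMem_tsupport fun h => hz (hrs h)
  have hφ'0 : ∀ z, z ∉ Icc (-r) r → deriv φ z = 0 := fun z hz =>
    image_eq_zero_of_notMem_tsupport fun h => hz (hrs (tsupport_deriv_subset h))
  have hrs' : ∀ z, z ∉ Icc (-s) s → z ∉ Icc (-r) r := fun z hz h =>
    hz ⟨by linarith [h.1], by linarith [h.2]⟩
  have hint := intervalIntegrable_of_locallyIntegrableOn hg (a := -s) (b := s)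
      ⟨by linarith, by linarith⟩ ⟨by linarith, hs.2⟩
  have h0 : (0 : ℝ) ∈ uIcc (-s) s := by
    rw [uIcc_of_le (by linarith)]; constructor <;> linarith
  have hFac := hint.absolutelyContinuousOnInterval_intervalIntegral h0
  have hφac : AbsolutelyContinuousOnInterval φ (-s) s := by
    obtain ⟨K, hK⟩ := (hφ.of_le (by simp : (1 : WithTop ℕ∞) ≤ ∞)).contDiffOn.exists_lipschitzOnWith
      (s := uIcc (-s) s) (by simp) (convex_uIcc _ _) isCompact_uIcc
    exact hK.absolutelyContinuousOnInterval
  have key := hFac.integral_mul_deriv_eq_deriv_mul hφac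
  rw [hφ0 s (fun h => by linarith [h.2]), hφ0 (-s) (fun h => by linarith [h.1])] at key
  rw [integral_Ioo_eq_of_support ⟨hs0, hs.2⟩ fun z hz => by rw [hφ'0 z (hrs' z hz), mul_zero],
    integral_Ioo_eq_of_support ⟨hs0, hs.2⟩ fun z hz => by rw [hφ0 z (hrs' z hz), mul_zero],
    key]
  simp only [mul_zero, sub_self, zero_sub]
  congr 1
  refine intervalIntegral.integral_congr_ae ?_
  filter_upwards [hint.ae_hasDerivAt_integral] with z hz hz'
  rw [(hz (uIoc_subset_uIcc hz') 0 h0).deriv]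

/-- The du Bois-Reymond lemma on `(-1, 1)`. -/
lemma ae_eq_const_of_integral_mul_deriv_eq_zero {h : ℝ → ℝ}
    (hloc : LocallyIntegrableOn h (Ioo (-1 : ℝ) 1))
    (hzero : ∀ φ : ℝ → ℝ, ContDiff ℝ ∞ φ → HasCompactSupport φ → tsupport φ ⊆ Ioo (-1 : ℝ) 1 →
      ∫ z in Ioo (-1 : ℝ) 1, h z * deriv φ z = 0) :
    ∃ c, ∀ᵐ z, z ∈ Ioo (-1 : ℝ) 1 → h z = c := by
  let b : ContDiffBump (0 : ℝ) := ⟨1 / 4, 1 / 2, by norm_num, by norm_num⟩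
  set η : ℝ → ℝ := b.normed volume with hη_def
  have hη : ContDiff ℝ ∞ η := b.contDiff_normed
  have hη1 : ∫ z, η z = 1 := b.integral_normed
  have hηt : tsupport η = Icc (-(1 / 2)) (1 / 2) := by
    rw [hη_def, b.tsupport_normed_eq, Real.closedBall_eq_Icc]
    norm_num [b]
  have hηc : HasCompactSupport η := b.hasCompactSupport_normed
  have hint : ∀ ψ : ℝ → ℝ, Continuous ψ → HasCompactSupport ψ → tsupport ψ ⊆ Ioo (-1 : ℝ) 1 →
      IntegrableOn (fun z => h z * ψ z) (Ioo (-1) 1) := by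
    intro ψ hψ hc hs
    have h1 : IntegrableOn (fun z => h z * ψ z) (tsupport ψ) :=
      (hloc.integrableOn_compact_subset hs hc).mul_continuousOn hψ.continuousOn hc
    refine (integrableOn_iff_integrable_of_support_subset (s := tsupport ψ) ?_).1 h1
      |>.integrableOn
    intro z hz
    exact subset_tsupport ψ fun h0 => hz (by simp [h0])
  refine ⟨∫ z in Ioo (-1 : ℝ) 1, h z * η z, ?_⟩
  set c := ∫ z in Ioo (-1 : ℝ) 1, h z * η z
  suffices hs : ∀ᵐ z, z ∈ Ioo (-1 : ℝ) 1 → h z - c = 0 by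
    filter_upwards [hs] with z hz hz' using sub_eq_zero.1 (hz hz')
  refine isOpen_Ioo.ae_eq_zero_of_integral_contDiff_smul_eq_zero
    (hloc.sub ((continuous_const.locallyIntegrable).locallyIntegrableOn _))
    fun ψ hψ hψc hψs => ?_
  set I := ∫ z, ψ z
  -- Removing the multiple `I η` of the unit-mass bump gives integral zero, so the primitive `Φ` of
  -- `θ` has compact support and is a legitimate test function.
  set θ : ℝ → ℝ := fun z => ψ z - I * η z with hθ
  have hθc : ContDiff ℝ ∞ θ := hψ.sub (contDiff_const.mul hη)
  have hηs : tsupport η ⊆ Ioo (-1 : ℝ) 1 := by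
    rw [hηt]; exact fun z hz => ⟨by linarith [hz.1], by linarith [hz.2]⟩
  obtain ⟨r, hr, hrs⟩ := exists_subset_Icc_of_isCompact (hψc.isCompact.union hηc)
    (union_subset hψs hηs)
  have hθ0 : ∀ z, z ∉ Icc (-r) r → θ z = 0 := fun z hz => by
    have h1 : ψ z = 0 := image_eq_zero_of_notMem_tsupport fun h => hz (hrs (Or.inl h))
    have h2 : η z = 0 := image_eq_zero_of_notMem_tsupport fun h => hz (hrs (Or.inr h))
    simp [hθ, h1, h2]
  have hψi : Integrable ψ := hψ.continuous.integrable_of_hasCompactSupport hψc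
  have hηi : Integrable η := hη.continuous.integrable_of_hasCompactSupport hηc
  have hθI : ∫ z, θ z = 0 := by
    rw [hθ, integral_sub hψi (hηi.const_mul I), integral_const_mul, hη1]
    simp [I]
  set Φ : ℝ → ℝ := fun z => ∫ x in (-1 : ℝ)..z, θ x with hΦ
  have hΦd : ∀ z, HasDerivAt Φ (θ z) z := fun z =>
    intervalIntegral.integral_hasDerivAt_right (hθc.continuous.intervalIntegrable _ _)
      hθc.continuous.aestronglyMeasurable.stronglyMeasurableAtFilter hθc.continuous.continuousAt
  have hderiv : deriv Φ = θ := funext fun z => (hΦd z).deriv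
  have hΦs : ContDiff ℝ ∞ Φ := by
    rw [contDiff_infty_iff_deriv, hderiv]
    exact ⟨fun z => (hΦd z).differentiableAt, hθc⟩
  have hΦ0 : ∀ z, z ∉ Icc (-r) r → Φ z = 0 := by
    intro z hz
    rcases lt_or_ge z (-r) with h1 | h1
    · refine (intervalIntegral.integral_congr (g := fun _ => 0) fun x hx => hθ0 x fun hx' => ?_).trans
        (by simp)
      have := hx.2
      have h3 := hx'.1
      have h4 : max (-1) z < -r := max_lt (by linarith [hr.2]) h1
      linarith
    · have h2 : r < z := by
        by_contra! h2; exact hz ⟨h1, h2⟩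
      rw [← hθI]
      refine intervalIntegral.integral_eq_integral_of_support_subset fun x hx => ?_
      have hx' : x ∈ Icc (-r) r := by
        by_contra h3; exact hx (hθ0 x h3)
      exact ⟨by linarith [hx'.1, hr.2], by linarith [hx'.2]⟩
  have hΦt : tsupport Φ ⊆ Icc (-r) r := closure_minimal
    (fun z hz => by by_contra h3; exact hz (hΦ0 z h3)) isClosed_Icc
  have hz0 := hzero Φ hΦs (HasCompactSupport.of_support_subset_isCompact isCompact_Icc
    (subset_closure.trans hΦt)) (hΦt.trans fun z hz =>
      ⟨by linarith [hz.1, hr.2], by linarith [hz.2, hr.2]⟩)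
  rw [hderiv] at hz0
  have i1 := hint ψ hψ.continuous hψc hψs
  have i2 := hint η hη.continuous hηc hηs
  have e1 : ∀ z, h z * θ z = h z * ψ z - I * (h z * η z) := fun z => by simp only [hθ]; ring
  simp only [e1] at hz0
  rw [integral_sub i1 (i2.const_mul I), integral_const_mul] at hz0
  have e2 : ∫ z in Ioo (-1 : ℝ) 1, ψ z = I :=
    setIntegral_eq_integral_of_forall_compl_eq_zero fun z hz =>
      image_eq_zero_of_notMem_tsupport fun h => hz (hψs h)
  rw [← setIntegral_eq_integral_of_forall_compl_eq_zero (s := Ioo (-1 : ℝ) 1) fun z hz => by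
    rw [image_eq_zero_of_notMem_tsupport fun h => hz (hψs h), zero_smul]]
  have e3 : ∀ z, ψ z • (h z - c) = h z * ψ z - c * ψ z := fun z => by
    rw [smul_eq_mul]; ring
  simp only [e3]
  rw [integral_sub i1 (hψi.integrableOn.const_mul c), integral_const_mul, e2]
  linarith

/-- A function with a weak derivative is a.e. the primitive of that derivative. -/
lemma HasWeakDeriv.ae_eq_primitive {f f' : ℝ → ℝ} (hf : HasWeakDeriv f f') :
    ∃ c, ∀ᵐ z, z ∈ Ioo (-1 : ℝ) 1 → f z = c + ∫ x in (0 : ℝ)..z, f' x := by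
  have hF := (continuousOn_primitive hf.locInt_deriv).locallyIntegrableOn (μ := volume)
    measurableSet_Ioo
  obtain ⟨c, hc⟩ := ae_eq_const_of_integral_mul_deriv_eq_zero (hf.locInt.sub hF) (by
    intro φ hφ hφc hφs
    have hint : ∀ g : ℝ → ℝ, LocallyIntegrableOn g (Ioo (-1 : ℝ) 1) →
        IntegrableOn (fun z => g z * deriv φ z) (Ioo (-1) 1) := by
      intro g hg
      have hs : tsupport (deriv φ) ⊆ Ioo (-1 : ℝ) 1 := tsupport_deriv_subset.trans hφs
      have h1 : IntegrableOn (fun z => g z * deriv φ z) (tsupport (deriv φ)) :=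
        (hg.integrableOn_compact_subset hs hφc.deriv).mul_continuousOn
          (hφ.continuous_deriv (by simp)).continuousOn hφc.deriv
      refine (integrableOn_iff_integrable_of_support_subset ?_).1 h1 |>.integrableOn
      intro z hz
      exact subset_tsupport _ fun h0 => hz (by simp [h0])
    simp only [Pi.sub_apply, sub_mul]
    rw [integral_sub (hint _ hf.locInt) (hint _ hF), hf.integral_eq φ hφ hφc hφs,
      integral_primitive_mul_deriv hf.locInt_deriv hφ hφc hφs, sub_self])
  refine ⟨c, ?_⟩
  filter_upwards [hc] with z hz hz'
  have := hz hz'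
  simp only [Pi.sub_apply] at this
  linarith

/-! ### The subcritical embedding -/

lemma energy_eq (hd : 2 ≤ d) (h : ℝ → ℝ) : ∫ z, h z ^ 2 * nu z ∂(nuMeasure d) =
    ∫ z in Ioo (-1 : ℝ) 1, h z ^ 2 * nu z * weight d z := by
  rw [integral_nuMeasure hd, intervalIntegral.integral_of_le (by norm_num),
    integral_Ioc_eq_integral_Ioo]

lemma uIoc_subset_Ioo {z : ℝ} (hz : z ∈ Ioo (-1 : ℝ) 1) : uIoc 0 z ⊆ Ioo (-1 : ℝ) 1 :=
  uIoc_subset_uIcc.trans (ordConnected_Ioo.uIcc_subset zero_mem_Ioo hz)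

/-- The Cauchy-Schwarz inequality for the energy. -/
lemma sq_primitive_le (hd : 2 ≤ d) {h : ℝ → ℝ} (hloc : LocallyIntegrableOn h (Ioo (-1 : ℝ) 1))
    (hint : Integrable (fun z => h z ^ 2 * nu z) (nuMeasure d)) {z : ℝ}
    (hz : z ∈ Ioo (-1 : ℝ) 1) :
    (∫ x in (0 : ℝ)..z, h x) ^ 2 ≤ (∫ z, h z ^ 2 * nu z ∂(nuMeasure d)) *
      ∫ x in uIoc 0 z, 1 / (nu x * weight d x) := by
  have hS := uIoc_subset_Ioo hz
  have hcc : ContinuousOn (fun x => 1 / (nu x * weight d x)) (uIcc 0 z) := by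
    have h1 := continuous_nu
    have h2 := continuous_weight hd
    refine continuousOn_const.div (by fun_prop) fun x hx => ?_
    have hx' := ordConnected_Ioo.uIcc_subset zero_mem_Ioo hz hx
    exact (mul_pos (nu_pos hx') (weight_pos hd hx')).ne'
  have i1 : IntegrableOn (fun z => h z ^ 2 * nu z * weight d z) (Ioo (-1) 1) :=
    (integrable_nuMeasure_iff hd).1 hint
  have i1' := i1.mono_set hS
  have i2 : IntegrableOn h (uIoc 0 z) :=
    intervalIntegrable_iff.1 (intervalIntegrable_of_locallyIntegrableOn hloc zero_mem_Ioo hz)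
  have i3 : IntegrableOn (fun x => 1 / (nu x * weight d x)) (uIoc 0 z) :=
    intervalIntegrable_iff.1 hcc.intervalIntegrable
  have hE : ∫ x in uIoc 0 z, h x ^ 2 * nu x * weight d x ≤
      ∫ z, h z ^ 2 * nu z ∂(nuMeasure d) := by
    rw [energy_eq hd]
    refine setIntegral_mono_set i1 ?_ hS.eventuallyLE
    filter_upwards [ae_restrict_mem measurableSet_Ioo] with x hx
    exact mul_nonneg (mul_nonneg (sq_nonneg _) (nu_pos hx).le) (weight_pos hd hx).le
  -- Cauchy-Schwarz by discriminant: the quadratic is the integral of `(h t νw + 1)² / (νw)`, with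
  -- `w` the weight.
  have hquad : ∀ t : ℝ, 0 ≤ (∫ x in uIoc 0 z, h x ^ 2 * nu x * weight d x) * (t * t) +
      2 * (∫ x in uIoc 0 z, h x) * t + ∫ x in uIoc 0 z, 1 / (nu x * weight d x) := by
    intro t
    have e : (∫ x in uIoc 0 z, h x ^ 2 * nu x * weight d x) * (t * t) +
      2 * (∫ x in uIoc 0 z, h x) * t + ∫ x in uIoc 0 z, 1 / (nu x * weight d x) =
      ∫ x in uIoc 0 z, (h x ^ 2 * nu x * weight d x * (t * t) + h x * (2 * t) +
        1 / (nu x * weight d x)) := by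
      rw [integral_add _ i3, integral_add (i1'.mul_const _) (i2.mul_const _), integral_mul_const,
        integral_mul_const]
      · ring
      · exact (i1'.mul_const _).add (i2.mul_const _)
    rw [e]
    refine setIntegral_nonneg measurableSet_uIoc fun x hx => ?_
    have hs : 0 < nu x * weight d x := mul_pos (nu_pos (hS hx)) (weight_pos hd (hS hx))
    have e2 : h x ^ 2 * nu x * weight d x * (t * t) + h x * (2 * t) + 1 / (nu x * weight d x) =
      (h x * t * (nu x * weight d x) + 1) ^ 2 / (nu x * weight d x) := by
      have hn := (nu_pos (hS hx)).ne'
      have hw := (weight_pos hd (hS hx)).ne'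
      field_simp
      ring
    rw [e2]
    positivity
  have hdisc := discrim_le_zero hquad
  have habs : (∫ x in (0 : ℝ)..z, h x) ^ 2 = (∫ x in uIoc 0 z, h x) ^ 2 := by
    rw [← sq_abs, intervalIntegral.abs_integral_eq_abs_integral_uIoc, sq_abs]
  have h3 : 0 ≤ ∫ x in uIoc 0 z, 1 / (nu x * weight d x) :=
    setIntegral_nonneg measurableSet_uIoc fun x hx =>
      (one_div_pos.2 (mul_pos (nu_pos (hS hx)) (weight_pos hd (hS hx)))).le
  rw [habs]
  unfold discrim at hdisc
  nlinarith [mul_le_mul_of_nonneg_right hE h3]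

/-- The integrand is `Z ν^(-d/2)`, while `x ν^(-s)` has derivative `ν^(-s-1) (ν + 2s x²) ≥ min(1,
2s) ν^(-s-1)` because `ν + x² = 1`; `s ≥ d/2 - 1` compares the two powers. Taking `s > 0` also
covers the logarithmic growth when `d = 2`. -/
lemma integral_inv_nu_mul_weight_le (hd : 2 ≤ d) {s : ℝ} (hs : 0 < s) (hsd : (d : ℝ) / 2 - 1 ≤ s)
    {z : ℝ} (hz : z ∈ Ioo (-1 : ℝ) 1) :
    ∫ x in uIoc 0 z, 1 / (nu x * weight d x) ≤ Z d / min 1 (2 * s) * nu z ^ (-s) := by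
  have hS := uIoc_subset_Ioo hz
  have hS' := ordConnected_Ioo.uIcc_subset zero_mem_Ioo hz
  set c := min 1 (2 * s) with hc
  have hc0 : 0 < c := by positivity
  have hZ := Z_pos hd
  set B' : ℝ → ℝ := fun x => nu x ^ (-s) + x * (-2 * x * (-s) * nu x ^ (-s - 1)) with hB'
  have hderiv : ∀ x ∈ uIcc 0 z, HasDerivAt (fun x => x * nu x ^ (-s)) (B' x) x := by
    intro x hx
    have h1 := (hasDerivAt_id x).mul ((hasDerivAt_nu x).rpow_const (p := -s)
      (Or.inl (nu_pos (hS' hx)).ne'))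
    convert! h1 using 1
    simp [hB']
  have hr : ∀ r : ℝ, ContinuousOn (fun x => nu x ^ r) (uIcc 0 z) := fun r =>
    continuous_nu.continuousOn.rpow_const fun x hx => Or.inl (nu_pos (hS' hx)).ne'
  have hB'c : ContinuousOn B' (uIcc 0 z) := by
    have h1 := hr (-s)
    have h2 := hr (-s - 1)
    fun_prop
  have hle : ∀ x ∈ uIoc 0 z, 1 / (nu x * weight d x) ≤ Z d / c * B' x := by
    intro x hx
    have hn := nu_pos (hS hx)
    have h1 : nu x ^ (-s) = nu x ^ (-s - 1) * nu x := by
      rw [← Real.rpow_add_one hn.ne']; ring_nf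
    have h2 : c * nu x ^ (-s - 1) ≤ B' x := by
      have hp := Real.rpow_pos_of_pos hn (-s - 1)
      have e : B' x = nu x ^ (-s - 1) * (nu x * 1 + x ^ 2 * (2 * s)) := by
        simp only [hB', h1]; ring
      rw [e, mul_comm]
      refine mul_le_mul_of_nonneg_left ?_ hp.le
      have e2 : c = nu x * c + x ^ 2 * c := by unfold nu; ring
      rw [e2]
      gcongr
      · exact min_le_left _ _
      · exact min_le_right _ _
    have h3 : 1 / (nu x * weight d x) = Z d * nu x ^ (-((d : ℝ) / 2)) := by
      rw [weight, Real.rpow_neg hn.le, Real.rpow_sub_one hn.ne']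
      have := Real.rpow_pos_of_pos hn ((d : ℝ) / 2)
      field_simp
    have h4 : nu x ^ (-((d : ℝ) / 2)) ≤ nu x ^ (-s - 1) :=
      Real.rpow_le_rpow_of_exponent_ge hn (nu_le_one x) (by linarith)
    rw [h3, div_mul_eq_mul_div, le_div_iff₀ hc0, mul_assoc]
    refine mul_le_mul_of_nonneg_left ?_ hZ.le
    nlinarith
  have hi : IntegrableOn (fun x => Z d / c * B' x) (uIoc 0 z) :=
    (intervalIntegrable_iff.1 hB'c.intervalIntegrable).const_mul _
  have hpos : ∀ x ∈ uIoc 0 z, 0 ≤ 1 / (nu x * weight d x) := fun x hx =>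
    (one_div_pos.2 (mul_pos (nu_pos (hS hx)) (weight_pos hd (hS hx)))).le
  have h1 : ∫ x in uIoc 0 z, 1 / (nu x * weight d x) ≤ ∫ x in uIoc 0 z, Z d / c * B' x :=
    integral_mono_of_nonneg ((ae_restrict_mem measurableSet_uIoc).mono hpos) hi
      ((ae_restrict_mem measurableSet_uIoc).mono hle)
  have h2 : ∫ x in uIoc 0 z, B' x ≤ nu z ^ (-s) := by
    refine (le_abs_self _).trans ?_
    rw [← intervalIntegral.abs_integral_eq_abs_integral_uIoc,
      intervalIntegral.integral_eq_sub_of_hasDerivAt hderiv hB'c.intervalIntegrable]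
    have := Real.rpow_pos_of_pos (nu_pos hz) (-s)
    rw [zero_mul, sub_zero, abs_mul, abs_of_pos this]
    exact mul_le_of_le_one_left this.le (abs_lt.2 hz).le
  rw [integral_const_mul] at h1
  exact h1.trans (mul_le_mul_of_nonneg_left h2 (by positivity))

/-- The pointwise form of the subcritical embedding of `H¹` into `L^p`. -/
lemma exists_embedding_weight (hd : 2 ≤ d) {p : ℝ} (hp : 2 < p) (hp' : p * ((d : ℝ) - 2) < 2 * d) :
    ∃ W : ℝ → ℝ, (∀ z, 0 ≤ W z) ∧ MemLp W (ENNReal.ofReal p) (nuMeasure d) ∧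
      ∀ h : ℝ → ℝ, LocallyIntegrableOn h (Ioo (-1 : ℝ) 1) →
        Integrable (fun z => h z ^ 2 * nu z) (nuMeasure d) → ∀ z ∈ Ioo (-1 : ℝ) 1,
        |∫ x in (0 : ℝ)..z, h x| ≤ √(∫ z, h z ^ 2 * nu z ∂(nuMeasure d)) * W z := by
  have hp0 : 0 < p := by linarith
  -- The lower bound on `s` gives the pointwise estimate and the upper bound puts `ν^(-s/2)` in
  -- `L^p`; subcriticality of `p` is exactly the room between them.
  obtain ⟨s, hs1, hs2⟩ : ∃ s : ℝ, (d : ℝ) / 2 - 1 < s ∧ s < d / p :=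
    exists_between (by rw [lt_div_iff₀ hp0]; linarith)
  have hs0 : 0 < s := (half_sub_one_nonneg hd).trans_lt hs1
  rw [lt_div_iff₀ hp0] at hs2
  have hZ := Z_pos hd
  set K := Z d / min 1 (2 * s)
  have hK : 0 ≤ K := by positivity
  have hW0 : ∀ z, 0 ≤ |√K * nu z ^ (-s / 2)| := fun z => abs_nonneg _
  refine ⟨fun z => |√K * nu z ^ (-s / 2)|, hW0, ?_, ?_⟩
  · have hmeas : Measurable fun z => |√K * nu z ^ (-s / 2)| :=
      (measurable_const.mul (continuous_nu.measurable.pow_const _)).abs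
    refine (integrable_norm_rpow_iff hmeas.aestronglyMeasurable (by simpa using hp0)
      (by simp)).1 ?_
    rw [ENNReal.toReal_ofReal hp0.le, integrable_nuMeasure_iff hd]
    set σ := ((d : ℝ) - s * p) / 2 with hσ
    have hσ0 : 0 < σ := by simp only [hσ]; linarith
    have hint : IntegrableOn (fun z => nu z ^ (σ - 1)) (Ioo (-1) 1) := by
      have h1 : IntervalIntegrable (fun z => nu z ^ (σ - 1)) volume (-1) 1 := by
        -- A non-integrable function has integral `0` by convention, so the positive value of the
        -- beta integral proves integrability.
        refine intervalIntegral.intervalIntegrable_of_integral_ne_zero ?_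
        rw [integral_rpow_nu hσ0]
        have := Real.Gamma_pos_of_pos hσ0
        have := Real.Gamma_pos_of_pos (by linarith : 0 < σ + 1 / 2)
        positivity
      exact ((intervalIntegrable_iff_integrableOn_Ioc_of_le (by norm_num)).1 h1).mono_set
        Ioo_subset_Ioc_self
    refine (integrableOn_congr_fun (fun z hz => ?_) measurableSet_Ioo).1
      (hint.const_mul ((√K) ^ p * (Z d)⁻¹))
    have hn := nu_pos hz
    simp only [Real.norm_eq_abs, abs_abs]
    rw [abs_of_nonneg (by positivity), Real.mul_rpow (by positivity) (by positivity), weight,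
      ← Real.rpow_mul hn.le]
    have e : nu z ^ (σ - 1) = nu z ^ (-s / 2 * p) * nu z ^ ((d : ℝ) / 2 - 1) := by
      rw [← Real.rpow_add hn]
      congr 1
      simp only [hσ]; ring
    rw [e]
    ring
  · intro h hloc hint z hz
    have h1 := sq_primitive_le hd hloc hint hz
    have h2 := integral_inv_nu_mul_weight_le hd hs0 hs1.le hz
    have hE : 0 ≤ ∫ z, h z ^ 2 * nu z ∂(nuMeasure d) := integral_nonneg_of_ae <|
      ae_mem_Icc.mono fun z hz => mul_nonneg (sq_nonneg _) (nu_nonneg hz)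
    refine abs_le_of_sq_le_sq ?_ (by positivity)
    have hn := nu_pos hz
    have e : (nu z ^ (-s / 2)) ^ 2 = nu z ^ (-s) := by
      rw [← Real.rpow_natCast, ← Real.rpow_mul hn.le]
      congr 1
      push_cast
      ring
    rw [mul_pow, Real.sq_sqrt hE, sq_abs, mul_pow, Real.sq_sqrt hK, e]
    exact h1.trans (mul_le_mul_of_nonneg_left h2 hE)

/-! ### Approximation in energy -/

/-- Polynomials are dense for the energy. -/
lemma exists_polynomial_energy_le (hd : 2 ≤ d) {h : ℝ → ℝ}
    (hloc : LocallyIntegrableOn h (Ioo (-1 : ℝ) 1))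
    (hint : Integrable (fun z => h z ^ 2 * nu z) (nuMeasure d)) {ε : ℝ} (hε : 0 < ε) :
    ∃ r : ℝ[X], Integrable (fun z => (r.eval z - h z) ^ 2 * nu z) (nuMeasure d) ∧
      ∫ z, (r.eval z - h z) ^ 2 * nu z ∂(nuMeasure d) ≤ ε := by
  have := isProbabilityMeasure hd
  -- The energy is the squared `L²` norm of the derivative for the finite measure `ρ`, in which
  -- bounded continuous functions are dense; Weierstrass does the rest.
  set ρ := (nuMeasure d).withDensity fun z => ENNReal.ofReal (nu z) with hρ
  have hmeas : Measurable fun z => ENNReal.ofReal (nu z) :=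
    continuous_nu.measurable.ennreal_ofReal
  have htr : ∀ g : ℝ → ℝ, ∫ z, g z ∂ρ = ∫ z, g z * nu z ∂(nuMeasure d) := by
    intro g
    rw [hρ, integral_withDensity_eq_integral_toReal_smul₀ hmeas.aemeasurable (by simp)]
    refine integral_congr_ae (ae_mem_Icc.mono fun z hz => ?_)
    simp only [smul_eq_mul]
    rw [ENNReal.toReal_ofReal (nu_nonneg hz), mul_comm]
  have hti : ∀ g : ℝ → ℝ, Integrable g ρ ↔ Integrable (fun z => g z * nu z) (nuMeasure d) := by
    intro g
    rw [hρ, integrable_withDensity_iff hmeas (by simp)]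
    refine integrable_congr (ae_mem_Icc.mono fun z hz => ?_)
    simp only
    rw [ENNReal.toReal_ofReal (nu_nonneg hz)]
  have hfin : IsFiniteMeasure ρ := by
    have h1 : Integrable (fun _ => (1 : ℝ)) ρ := by
      rw [hti]
      exact integrable_of_continuousOn hd (continuous_const.mul continuous_nu).continuousOn
    rcases integrable_const_iff.1 h1 with h2 | h2
    · exact absurd h2 one_ne_zero
    · exact h2
  have hac : ρ ≪ nuMeasure d := withDensity_absolutelyContinuous _ _
  have hsm : AEStronglyMeasurable h ρ :=
    (hloc.aestronglyMeasurable.mono_ac nuMeasure_absolutelyContinuous).mono_ac hac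
  have hmem : MemLp h (ENNReal.ofReal 2) ρ := by
    rw [show ENNReal.ofReal 2 = 2 by simp, memLp_two_iff_integrable_sq hsm]
    exact (hti _).2 hint
  obtain ⟨g, hg, hgmem⟩ := hmem.exists_boundedContinuous_integral_rpow_sub_le (by norm_num)
    (ε := ε / 4) (by positivity)
  obtain ⟨r, hr⟩ := exists_polynomial_near_of_continuousOn (-1) 1 g g.continuous.continuousOn
    (√(ε / 4)) (by positivity)
  have i1 : Integrable (fun z => (h z - g z) ^ 2) ρ := by
    have h1 := (hmem.sub hgmem).integrable_norm_rpow (by simp) (by simp)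
    simpa using h1
  have i2 : Integrable (fun z => (h z - g z) ^ 2 * nu z) (nuMeasure d) := (hti _).1 i1
  have hg' : ∫ z, (h z - g z) ^ 2 * nu z ∂(nuMeasure d) ≤ ε / 4 := by
    rw [← htr]
    simpa using hg
  have hbound : ∀ z ∈ Icc (-1 : ℝ) 1, (r.eval z - h z) ^ 2 * nu z ≤
      2 * ((h z - g z) ^ 2 * nu z) + ε / 2 := by
    intro z hz
    have h1 := hr z hz
    have h2 : (r.eval z - g z) ^ 2 ≤ ε / 4 := by
      rw [← Real.sq_sqrt (by positivity : 0 ≤ ε / 4)]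
      exact sq_le_sq' (by linarith [(abs_lt.1 h1).1]) (abs_lt.1 h1).2.le
    have h3 := nu_nonneg hz
    have h4 := nu_le_one z
    have h5 : (r.eval z - h z) ^ 2 ≤ 2 * (h z - g z) ^ 2 + 2 * (r.eval z - g z) ^ 2 := by
      nlinarith [sq_nonneg (r.eval z - g z + (h z - g z))]
    nlinarith
  have i3 : Integrable (fun z => 2 * ((h z - g z) ^ 2 * nu z) + ε / 2) (nuMeasure d) :=
    (i2.const_mul 2).add (integrable_const _)
  have i4 : Integrable (fun z => (r.eval z - h z) ^ 2 * nu z) (nuMeasure d) := by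
    refine i3.mono' ?_ (ae_mem_Icc.mono fun z hz => ?_)
    · exact ((r.continuous.aestronglyMeasurable.sub
        (hloc.aestronglyMeasurable.mono_ac nuMeasure_absolutelyContinuous)).pow 2).mul
        continuous_nu.aestronglyMeasurable
    · rw [Real.norm_of_nonneg (mul_nonneg (sq_nonneg _) (nu_nonneg hz))]
      exact hbound z hz
  refine ⟨r, i4, (integral_mono_ae i4 i3 (ae_mem_Icc.mono hbound)).trans ?_⟩
  rw [integral_add (i2.const_mul 2) (integrable_const _), integral_const_mul]
  simp
  linarith

/-- The exponent `2^#` lies below the critical Sobolev exponent, since `2d(d-1)² - (2d²+1)(d-2) = d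
+ 2 > 0`. The product form also makes sense for `d = 2`. -/
lemma subcritical_of_lt_twoSharp (hd : 2 ≤ d) {p : ℝ} (hp' : p < twoSharp d) :
    p * ((d : ℝ) - 2) < 2 * d := by
  have hd1 : (2 : ℝ) ≤ d := by exact_mod_cast hd
  have h1 : 0 < ((d : ℝ) - 1) ^ 2 := by nlinarith
  rw [twoSharp, lt_div_iff₀ h1] at hp'
  rcases hd1.eq_or_lt with h2 | h2
  · rw [← h2]; norm_num
  · have h3 : (p * ((d : ℝ) - 2)) * (d - 1) ^ 2 < 2 * d * (d - 1) ^ 2 := by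
      have := mul_lt_mul_of_pos_right hp' (sub_pos.2 h2)
      nlinarith
    exact lt_of_mul_lt_mul_right h3 h1.le

/-- With `u = |G|^p + 2τ - δz`, the regularization costs at most `τ` in the derivative of `u^(1/p)`:
since `u ≥ |G|^p`, the factor of `G'` has modulus at most `1`, and since `u ≥ τ` and `|δ| ≤ τ²`, the
remainder is at most `τ^(1/p+1) ≤ τ`. -/
lemma sq_rpow_inv_deriv_le {p τ δ z G G' : ℝ} (hp : 2 < p) (hτ : 0 < τ) (hτ1 : τ ≤ 1)
    (hδ : |δ| ≤ τ ^ 2) (hz : |z| ≤ 1) :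
    (1 / p * (|G| ^ p + 2 * τ - δ * z) ^ (1 / p - 1) * (p * |G| ^ (p - 2) * G * G' - δ)) ^ 2 ≤
      (|G'| + τ) ^ 2 := by
  have hp0 : 0 < p := by linarith
  have hpinv : 1 / p ≤ 1 := by rw [div_le_one hp0]; linarith
  set u := |G| ^ p + 2 * τ - δ * z with hu
  have hGp : 0 ≤ |G| ^ p := Real.rpow_nonneg (abs_nonneg _) _
  have hδz : δ * z ≤ τ := by
    have h1 : |δ * z| ≤ τ ^ 2 := by
      rw [abs_mul]; nlinarith [abs_nonneg δ, abs_nonneg z]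
    nlinarith [le_abs_self (δ * z)]
  have huτ : τ ≤ u := by linarith
  have huG : |G| ^ p ≤ u := by linarith
  have hu0 : 0 < u := hτ.trans_le huτ
  have hr0 : 0 < u ^ (1 / p - 1) := Real.rpow_pos_of_pos hu0 _
  have h1 : |G| ^ (p - 2) * |G| * u ^ (1 / p - 1) ≤ 1 := by
    rcases eq_or_ne G 0 with rfl | hG
    · simp
    have hG0 : 0 < |G| := abs_pos.2 hG
    have e1 : |G| ^ (p - 2) * |G| = (|G| ^ p) ^ (1 - 1 / p) := by
      rw [← Real.rpow_mul hG0.le, ← Real.rpow_add_one hG0.ne']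
      congr 1
      field_simp
      ring
    rw [e1]
    calc (|G| ^ p) ^ (1 - 1 / p) * u ^ (1 / p - 1)
        ≤ u ^ (1 - 1 / p) * u ^ (1 / p - 1) := by
          gcongr
      _ = 1 := by rw [← Real.rpow_add hu0]; simp
  have h2 : u ^ (1 / p - 1) * |δ| ≤ τ := by
    calc u ^ (1 / p - 1) * |δ| ≤ τ ^ (1 / p - 1) * τ ^ 2 :=
          mul_le_mul (Real.rpow_le_rpow_of_nonpos hτ huτ (by linarith)) hδ (abs_nonneg _)
            (Real.rpow_nonneg hτ.le _)
      _ = τ ^ (1 / p + 1) := by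
          rw [← Real.rpow_natCast, ← Real.rpow_add hτ]
          congr 1
          push_cast
          ring
      _ ≤ τ ^ (1 : ℝ) := Real.rpow_le_rpow_of_exponent_ge hτ hτ1 (by
          have : 0 < 1 / p := by positivity
          linarith)
      _ = τ := Real.rpow_one τ
  refine sq_le_sq' ?_ ?_ <;> [apply neg_le_of_neg_le; skip] <;>
    [refine (neg_le_abs _).trans ?_; refine (le_abs_self _).trans ?_]
  all_goals
    rw [abs_mul, abs_of_pos (mul_pos (by positivity : 0 < 1 / p) hr0)]
    have h3 : |p * |G| ^ (p - 2) * G * G' - δ| ≤ p * (|G| ^ (p - 2) * |G|) * |G'| + |δ| := by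
      refine (abs_sub _ _).trans (le_of_eq ?_)
      rw [abs_mul, abs_mul, abs_mul, abs_of_pos hp0,
        abs_of_nonneg (Real.rpow_nonneg (abs_nonneg G) _)]
      ring
    calc 1 / p * u ^ (1 / p - 1) * |p * |G| ^ (p - 2) * G * G' - δ|
        ≤ 1 / p * u ^ (1 / p - 1) * (p * (|G| ^ (p - 2) * |G|) * |G'| + |δ|) := by gcongr
      _ = (|G| ^ (p - 2) * |G| * u ^ (1 / p - 1)) * |G'| + 1 / p * (u ^ (1 / p - 1) * |δ|) := by
          field_simp
      _ ≤ 1 * |G'| + 1 * τ := by gcongr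
      _ = |G'| + τ := by ring

/-- `H¹` functions belong to `L^p`, and are approximated by polynomials, in energy and with a
dominated pointwise convergence. -/
lemma MemH1.exists_approximation (hd : 2 ≤ d) {p : ℝ} (hp : 2 < p) (hp' : p < twoSharp d)
    {f f' : ℝ → ℝ} (hf : MemH1 d f f') :
    ∃ D : ℝ → ℝ, (∀ z, 0 ≤ D z) ∧ MemLp D (ENNReal.ofReal p) (nuMeasure d) ∧
      (∀ᵐ z ∂(nuMeasure d), |f z| ≤ D z) ∧ ∃ g : ℕ → ℝ[X],
        (∀ n, ∀ᵐ z ∂(nuMeasure d), |(g n).eval z| ≤ D z) ∧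
        (∀ᵐ z ∂(nuMeasure d), Tendsto (fun n => (g n).eval z) atTop (𝓝 (f z))) ∧
        (∀ n, Integrable (fun z => ((derivative (g n)).eval z - f' z) ^ 2 * nu z) (nuMeasure d)) ∧
        ∀ n : ℕ, ∫ z, ((derivative (g n)).eval z - f' z) ^ 2 * nu z ∂(nuMeasure d) ≤
          (1 / ((n : ℝ) + 1)) ^ 2 := by
  have := isProbabilityMeasure hd
  obtain ⟨W, hW0, hW, hWle⟩ := exists_embedding_weight hd hp (subcritical_of_lt_twoSharp hd hp')
  obtain ⟨c, hc⟩ := hf.weakDeriv.ae_eq_primitive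
  have hloc := hf.weakDeriv.locInt_deriv
  have hfae : ∀ᵐ z ∂(nuMeasure d), f z = c + ∫ x in (0 : ℝ)..z, f' x :=
    nuMeasure_absolutelyContinuous.ae_le ((ae_restrict_iff' measurableSet_Ioo).2 hc)
  set E := ∫ z, f' z ^ 2 * nu z ∂(nuMeasure d) with hE
  -- The normalization at `0` makes `g - f` a primitive, vanishing at `0`, of the difference of
  -- derivatives, so `W` controls it pointwise.
  have hex : ∀ n : ℕ, ∃ g : ℝ[X], g.eval 0 = c ∧
      Integrable (fun z => ((derivative g).eval z - f' z) ^ 2 * nu z) (nuMeasure d) ∧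
      ∫ z, ((derivative g).eval z - f' z) ^ 2 * nu z ∂(nuMeasure d) ≤
          (1 / ((n : ℝ) + 1)) ^ 2 := by
    intro n
    obtain ⟨r, hr1, hr2⟩ := exists_polynomial_energy_le hd hloc hf.energy
      (ε := (1 / ((n : ℝ) + 1)) ^ 2) (by positivity)
    obtain ⟨g, rfl, hg0⟩ := exists_antiderivative r c
    exact ⟨g, hg0, hr1, hr2⟩
  choose g hg0 hgi hgE using hex
  have hdist : ∀ n, ∀ z ∈ Ioo (-1 : ℝ) 1,
      |(g n).eval z - (c + ∫ x in (0 : ℝ)..z, f' x)| ≤ 1 / ((n : ℝ) + 1) * W z := by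
    intro n z hz
    have hl : LocallyIntegrableOn (fun z => (derivative (g n)).eval z - f' z) (Ioo (-1) 1) :=
      ((derivative (g n)).continuous.locallyIntegrable.locallyIntegrableOn _).sub hloc
    have h1 := hWle _ hl (hgi n) z hz
    rw [intervalIntegral.integral_sub ((derivative (g n)).continuous.intervalIntegrable _ _)
      (intervalIntegrable_of_locallyIntegrableOn hloc zero_mem_Ioo hz),
      intervalIntegral.integral_eq_sub_of_hasDerivAt (fun x _ => (g n).hasDerivAt x)
      ((derivative (g n)).continuous.intervalIntegrable _ _), hg0, sub_sub] at h1
    refine h1.trans (mul_le_mul_of_nonneg_right ?_ (hW0 z))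
    exact Real.sqrt_le_iff.2 ⟨by positivity, hgE n⟩
  have hWE : MemLp (fun z => √E * W z) (ENNReal.ofReal p) (nuMeasure d) := hW.const_mul _
  have hDm : MemLp (fun z => |c| + √E * W z + W z) (ENNReal.ofReal p) (nuMeasure d) :=
    ((memLp_const |c|).add hWE).add hW
  refine ⟨fun z => |c| + √E * W z + W z, fun z => by have := hW0 z; positivity,
    hDm, ?_, g, fun n => ?_, ?_, hgi, hgE⟩
  · filter_upwards [hfae, ae_mem_Ioo] with z hz hz'
    have h1 := hWle f' hloc hf.energy z hz'
    rw [hz]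
    linarith [abs_add_le c (∫ x in (0 : ℝ)..z, f' x), hW0 z]
  · filter_upwards [ae_mem_Ioo] with z hz'
    have h1 := hWle f' hloc hf.energy z hz'
    have h2 := hdist n z hz'
    have h3 : 1 / ((n : ℝ) + 1) ≤ 1 := by
      rw [div_le_one (by positivity)]; linarith [(Nat.cast_nonneg n : (0 : ℝ) ≤ n)]
    have h4 := mul_le_of_le_one_left (hW0 z) h3
    have h5 := abs_add_le c (∫ x in (0 : ℝ)..z, f' x)
    have h6 := abs_sub_abs_le_abs_sub ((g n).eval z) (c + ∫ x in (0 : ℝ)..z, f' x)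
    linarith
  · filter_upwards [hfae, ae_mem_Ioo] with z hz hz'
    rw [hz, tendsto_iff_dist_tendsto_zero]
    refine squeeze_zero (fun _ => dist_nonneg) (fun n => hdist n z hz') ?_
    simpa using (tendsto_one_div_add_atTop_nhds_zero_nat (𝕜 := ℝ)).mul_const (W z)

/-! ### The inequality on `H¹` -/

/-- The interpolation inequality for balanced functions of `H¹`. -/
lemma MemH1.interpolation (hd : 2 ≤ d) {p : ℝ} (hp : 2 < p) (hp' : p < twoSharp d)
    {f f' : ℝ → ℝ} (hf : MemH1 d f f') (hbal : ∫ z, z * |f z| ^ p ∂(nuMeasure d) = 0) :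
    MemLp f (ENNReal.ofReal p) (nuMeasure d) ∧
      flowConst d p / (p - 2) * ((∫ z, |f z| ^ p ∂(nuMeasure d)) ^ (1 / p)) ^ 2 ≤
        ∫ z, f' z ^ 2 * nu z ∂(nuMeasure d) +
          flowConst d p / (p - 2) * ∫ z, f z ^ 2 ∂(nuMeasure d) := by
  have := isProbabilityMeasure hd
  have hp0 : 0 < p := by linarith
  obtain ⟨D, hD0, hD, hfD, g, hgD, hglim, hgi, hgE⟩ := hf.exists_approximation hd hp hp'
  refine ⟨hD.mono hf.memL2.aestronglyMeasurable
    (hfD.mono fun z hz => by rwa [Real.norm_eq_abs, Real.norm_of_nonneg (hD0 z)]), ?_⟩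
  have hDi : Integrable (fun z => D z ^ p) (nuMeasure d) := by
    have h := hD.integrable_norm_rpow (by simpa using hp0) (by simp)
    rw [ENNReal.toReal_ofReal hp0.le] at h
    exact h.congr (Eventually.of_forall fun z => by simp only [Real.norm_of_nonneg (hD0 z)])
  have hpow : ∀ {a z : ℝ}, |a| ≤ D z → |a| ^ p ≤ D z ^ p := fun h =>
    Real.rpow_le_rpow (abs_nonneg _) h hp0.le
  have hGc : ∀ n, Continuous fun z => |(g n).eval z| ^ p := fun n =>
    (g n).continuous.abs.rpow_const fun _ => Or.inr hp0.le
  have hGlim : ∀ᵐ z ∂(nuMeasure d), Tendsto (fun n => |(g n).eval z| ^ p) atTop (𝓝 (|f z| ^ p)) :=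
    hglim.mono fun z hz => hz.abs.rpow_const (Or.inr hp0.le)
  set δ : ℕ → ℝ := fun n => (d + 1) * ∫ z, z * |(g n).eval z| ^ p ∂(nuMeasure d) with hδ
  have hδlim : Tendsto δ atTop (𝓝 0) := by
    have h : Tendsto (fun n => ∫ z, z * |(g n).eval z| ^ p ∂(nuMeasure d)) atTop
        (𝓝 (∫ z, z * |f z| ^ p ∂(nuMeasure d))) := by
      refine tendsto_integral_of_dominated_convergence (fun z => D z ^ p)
        (fun n => (continuous_id.mul (hGc n)).aestronglyMeasurable) hDi (fun n => ?_)
        (hGlim.mono fun z hz => hz.const_mul z)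
      filter_upwards [hgD n, ae_mem_Icc] with z hz hz'
      have h0 : 0 ≤ |(g n).eval z| ^ p := Real.rpow_nonneg (abs_nonneg _) _
      rw [Real.norm_eq_abs, abs_mul, abs_of_nonneg h0]
      exact (mul_le_of_le_one_left h0 (abs_le.2 hz')).trans (hpow hz)
    rw [hbal] at h
    simpa [hδ] using h.const_mul ((d : ℝ) + 1)
  set e : ℕ → ℝ := fun n => 1 / ((n : ℝ) + 1) with he
  have he0 : ∀ n, 0 < e n := fun n => Nat.one_div_pos_of_nat
  have helim : Tendsto e atTop (𝓝 0) := tendsto_one_div_add_atTop_nhds_zero_nat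
  -- Positive, infinitesimal, and large enough to dominate both `√|δ n|` and the energy error `e n`.
  set τ : ℕ → ℝ := fun n => √|δ n| + e n with hτ
  have hτ0 : ∀ n, 0 < τ n := fun n => add_pos_of_nonneg_of_pos (Real.sqrt_nonneg _) (he0 n)
  have hτlim : Tendsto τ atTop (𝓝 0) := by
    simpa using (hδlim.abs.sqrt).add helim
  have hτ1 : ∀ᶠ n in atTop, τ n ≤ 1 := hτlim.eventually (Iic_mem_nhds one_pos)
  have hδτ : ∀ n, |δ n| ≤ τ n ^ 2 := fun n => by
    have h1 := Real.sq_sqrt (abs_nonneg (δ n))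
    have h2 := Real.sqrt_nonneg |δ n|
    have h3 := he0 n
    simp only [hτ]
    nlinarith [mul_nonneg h2 h3.le]
  -- The term `δ z` restores the balance and `2τ` ensures `u ≥ τ > 0`; the latter does not disturb
  -- the balance because `∫ z = 0`.
  set u : ℕ → ℝ → ℝ := fun n z => |(g n).eval z| ^ p + 2 * τ n - δ n * z with hu
  set u' : ℕ → ℝ → ℝ := fun n z =>
    p * |(g n).eval z| ^ (p - 2) * (g n).eval z * (derivative (g n)).eval z - δ n with hu'
  have hud : ∀ n z, HasDerivAt (u n) (u' n z) z := by
    intro n z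
    have h1 := (hasDerivAt_abs_rpow ((g n).eval z) (by linarith : 1 < p)).comp z
      ((g n).hasDerivAt z)
    convert! (h1.add_const (2 * τ n)).sub ((hasDerivAt_id z).const_mul (δ n)) using 1
    simp [hu']
  have hu'c : ∀ n, Continuous (u' n) := by
    intro n
    have h1 : Continuous fun z => |(g n).eval z| ^ (p - 2) :=
      (g n).continuous.abs.rpow_const fun _ => Or.inr (by linarith)
    have h2 := (g n).continuous
    have h3 := (derivative (g n)).continuous
    fun_prop
  have huc : ∀ n, Continuous (u n) := fun n =>
    continuous_iff_continuousAt.2 fun z => (hud n z).continuousAt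
  have hδz : ∀ n, τ n ≤ 1 → ∀ z ∈ Icc (-1 : ℝ) 1, |δ n * z| ≤ τ n := fun n hn z hz => by
    rw [abs_mul]
    have h1 := mul_le_of_le_one_right (abs_nonneg (δ n)) (abs_le.2 hz)
    have h2 := hδτ n
    have h3 := hτ0 n
    nlinarith
  have hupos : ∀ n, τ n ≤ 1 → ∀ z ∈ Icc (-1 : ℝ) 1, 0 < u n z := fun n hn z hz => by
    have h1 := (abs_le.1 (hδz n hn z hz)).2
    have h2 : 0 ≤ |(g n).eval z| ^ p := Real.rpow_nonneg (abs_nonneg _) _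
    have h3 := hτ0 n
    simp only [hu]
    linarith
  have hubal : ∀ n, ∫ z, z * u n z ∂(nuMeasure d) = 0 := by
    intro n
    have h1 : ∀ z, z * u n z = z * |(g n).eval z| ^ p + 2 * τ n * z - δ n * z ^ 2 := fun z => by
      simp only [hu]; ring
    have i1 : Integrable (fun z => z * |(g n).eval z| ^ p) (nuMeasure d) :=
      integrable_of_continuousOn hd (continuous_id.mul (hGc n)).continuousOn
    have i2 : Integrable (fun z : ℝ => z) (nuMeasure d) :=
      integrable_of_continuousOn hd continuous_id.continuousOn
    have i3 : Integrable (fun z : ℝ => z ^ 2) (nuMeasure d) :=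
      integrable_of_continuousOn hd (by fun_prop)
    have hz : ∫ z : ℝ, z ∂(nuMeasure d) = 0 := by
      have := integral_mul_polyOp hd (1 : ℝ[X])
      have hd0 : (d : ℝ) ≠ 0 := by positivity
      simpa [polyOp_apply, hd0] using this
    simp only [h1]
    have i4 : Integrable (fun z => z * |(g n).eval z| ^ p + 2 * τ n * z) (nuMeasure d) :=
      i1.add (i2.const_mul _)
    rw [integral_sub i4 (i3.const_mul _),
      integral_add i1 (i2.const_mul _), integral_const_mul, integral_const_mul, integral_sq hd, hz]
    simp only [hδ]
    field_simp
    ring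
  have huD : ∀ᶠ n in atTop, ∀ᵐ z ∂(nuMeasure d), 0 ≤ u n z ∧ u n z ≤ D z ^ p + 3 := by
    filter_upwards [hτ1] with n hn
    filter_upwards [hgD n, ae_mem_Icc] with z hz hz'
    refine ⟨(hupos n hn z hz').le, ?_⟩
    have h1 := (abs_le.1 (hδz n hn z hz')).1
    have h2 := hpow hz
    simp only [hu]
    linarith
  have hulim : ∀ᵐ z ∂(nuMeasure d), Tendsto (fun n => u n z) atTop (𝓝 (|f z| ^ p)) := by
    filter_upwards [hGlim] with z hz
    simpa using (hz.add (hτlim.const_mul 2)).sub (hδlim.mul_const z)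
  have lim1 : Tendsto (fun n => ∫ z, u n z ∂(nuMeasure d)) atTop
      (𝓝 (∫ z, |f z| ^ p ∂(nuMeasure d))) := by
    refine tendsto_integral_filter_of_dominated_convergence (fun z => D z ^ p + 3)
      (Eventually.of_forall fun n => (huc n).aestronglyMeasurable) ?_
      (hDi.add (integrable_const _)) hulim
    filter_upwards [huD] with n hn
    filter_upwards [hn] with z hz
    rw [Real.norm_of_nonneg hz.1]
    exact hz.2
  -- Domination comes from `u^(2/p) ≤ 1 + u`, as `2/p ≤ 1`. A true limit is needed rather than a
  -- one-sided bound, since the sign of `flowConst` is unknown here.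
  have lim2 : Tendsto (fun n => ∫ z, (u n z ^ (1 / p)) ^ 2 ∂(nuMeasure d)) atTop
      (𝓝 (∫ z, f z ^ 2 ∂(nuMeasure d))) := by
    refine tendsto_integral_filter_of_dominated_convergence (fun z => D z ^ p + 4)
      (Eventually.of_forall fun n => (((huc n).rpow_const fun _ =>
        Or.inr (by positivity)).pow 2).aestronglyMeasurable) ?_
      (hDi.add (integrable_const _)) ?_
    · filter_upwards [huD] with n hn
      filter_upwards [hn] with z hz
      rw [Real.norm_of_nonneg (sq_nonneg _), ← Real.rpow_natCast, ← Real.rpow_mul hz.1]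
      have hex : 1 / p * ((2 : ℕ) : ℝ) ≤ 1 := by
        push_cast
        rw [div_mul_eq_mul_div, div_le_one hp0]
        linarith
      rcases le_total (u n z) 1 with h1 | h1
      · have := Real.rpow_le_one hz.1 h1 (by positivity : 0 ≤ 1 / p * ((2 : ℕ) : ℝ))
        linarith [Real.rpow_nonneg (hD0 z) p]
      · have := Real.rpow_le_rpow_of_exponent_le h1 hex
        rw [Real.rpow_one] at this
        linarith [hz.2]
    · filter_upwards [hulim] with z hz
      have h1 := (hz.rpow_const (p := 1 / p) (Or.inr (by positivity))).pow 2
      rwa [← Real.rpow_mul (abs_nonneg _), mul_one_div_cancel hp0.ne', Real.rpow_one,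
        sq_abs] at h1
  set E := ∫ z, f' z ^ 2 * nu z ∂(nuMeasure d) with hE
  set w' : ℕ → ℝ → ℝ := fun n z => 1 / p * u n z ^ (1 / p - 1) * u' n z with hw'
  have hrc : ∀ n, τ n ≤ 1 → ∀ r : ℝ, ContinuousOn (fun z => u n z ^ r) (Icc (-1) 1) :=
    fun n hn r => (huc n).continuousOn.rpow_const fun z hz => Or.inl (hupos n hn z hz).ne'
  have hw'c : ∀ n, τ n ≤ 1 → ContinuousOn (fun z => w' n z ^ 2 * nu z) (Icc (-1) 1) := by
    intro n hn
    have h1 := hrc n hn (1 / p - 1)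
    have h2 := (hu'c n).continuousOn (s := Icc (-1 : ℝ) 1)
    have h3 := continuous_nu.continuousOn (s := Icc (-1 : ℝ) 1)
    fun_prop
  -- Young's inequality `(x+y)² ≤ (1+τ) x² + (1+1/τ) y²` with the error `y²` of order `τ²`: the loss
  -- `(1+1/τ) 4τ² = 4τ² + 4τ` tends to zero.
  have henergy : ∀ n, τ n ≤ 1 → ∫ z, w' n z ^ 2 * nu z ∂(nuMeasure d) ≤
      (1 + τ n) * E + 4 * τ n ^ 2 + 4 * τ n := by
    intro n hn
    have ht := hτ0 n
    have i1 := (hf.energy).const_mul (1 + τ n)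
    have i2 := (hgi n).const_mul ((1 + 1 / τ n) * 2)
    have i3 : Integrable (fun _ : ℝ => (1 + 1 / τ n) * (2 * τ n ^ 2)) (nuMeasure d) :=
      integrable_const _
    have i4 : Integrable (fun z => (1 + τ n) * (f' z ^ 2 * nu z) +
        (1 + 1 / τ n) * 2 * (((derivative (g n)).eval z - f' z) ^ 2 * nu z)) (nuMeasure d) :=
      i1.add i2
    have hle : ∫ z, w' n z ^ 2 * nu z ∂(nuMeasure d) ≤
        ∫ z, ((1 + τ n) * (f' z ^ 2 * nu z) +
          (1 + 1 / τ n) * 2 * (((derivative (g n)).eval z - f' z) ^ 2 * nu z) +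
          (1 + 1 / τ n) * (2 * τ n ^ 2)) ∂(nuMeasure d) := by
      refine integral_mono_ae (integrable_of_continuousOn hd (hw'c n hn)) (i4.add i3)
        (ae_mem_Icc.mono fun z hz => ?_)
      have h1 := sq_rpow_inv_deriv_le (G := (g n).eval z) (G' := (derivative (g n)).eval z) hp
        (hτ0 n) hn (hδτ n) (abs_le.2 hz)
      change w' n z ^ 2 ≤ _ at h1
      have hn0 := nu_nonneg hz
      have hn1 := nu_le_one z
      set a := f' z
      set b := (derivative (g n)).eval z - a
      have h2 : |(derivative (g n)).eval z| + τ n ≤ |a| + (|b| + τ n) := by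
        have : |(derivative (g n)).eval z| ≤ |a| + |b| := by
          have := abs_add_le a b
          simpa [b] using this
        linarith
      have h3 : (|(derivative (g n)).eval z| + τ n) ^ 2 ≤ (|a| + (|b| + τ n)) ^ 2 := by
        gcongr
      have h4 : (|a| + (|b| + τ n)) ^ 2 ≤ (1 + τ n) * a ^ 2 +
          (1 + 1 / τ n) * (2 * b ^ 2 + 2 * τ n ^ 2) := by
        have h5 : (|a| + (|b| + τ n)) ^ 2 ≤ (1 + τ n) * |a| ^ 2 +
            (1 + 1 / τ n) * (|b| + τ n) ^ 2 := by
          have h6 : (1 + τ n) * |a| ^ 2 + (1 + 1 / τ n) * (|b| + τ n) ^ 2 -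
            (|a| + (|b| + τ n)) ^ 2 = (τ n * |a| - (|b| + τ n)) ^ 2 / τ n := by
            field_simp
            ring
          have : 0 ≤ (τ n * |a| - (|b| + τ n)) ^ 2 / τ n := by positivity
          linarith
        rw [sq_abs] at h5
        refine h5.trans ?_
        gcongr
        nlinarith [sq_nonneg (|b| - τ n), sq_abs b]
      calc w' n z ^ 2 * nu z
          ≤ ((1 + τ n) * a ^ 2 + (1 + 1 / τ n) * (2 * b ^ 2 + 2 * τ n ^ 2)) * nu z :=
            mul_le_mul_of_nonneg_right (h1.trans (h3.trans h4)) hn0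
        _ = (1 + τ n) * (a ^ 2 * nu z) + (1 + 1 / τ n) * 2 * (b ^ 2 * nu z) +
            (1 + 1 / τ n) * (2 * τ n ^ 2) * nu z := by ring
        _ ≤ (1 + τ n) * (a ^ 2 * nu z) + (1 + 1 / τ n) * 2 * (b ^ 2 * nu z) +
            (1 + 1 / τ n) * (2 * τ n ^ 2) :=
            add_le_add le_rfl (mul_le_of_le_one_right (by positivity) hn1)
    rw [integral_add i4 i3, integral_add i1 i2, integral_const_mul,
      integral_const_mul] at hle
    simp only [integral_const, probReal_univ, smul_eq_mul, one_mul] at hle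
    have h7 : (∫ z, ((derivative (g n)).eval z - f' z) ^ 2 * nu z ∂(nuMeasure d)) ≤ τ n ^ 2 := by
      refine (hgE n).trans ?_
      have h8 : e n ≤ τ n := le_add_of_nonneg_left (Real.sqrt_nonneg _)
      exact pow_le_pow_left₀ (he0 n).le h8 2
    calc _ ≤ _ := hle
      _ ≤ (1 + τ n) * E + (1 + 1 / τ n) * 2 * τ n ^ 2 + (1 + 1 / τ n) * (2 * τ n ^ 2) := by
          gcongr
      _ = (1 + τ n) * E + 4 * τ n ^ 2 + 4 * τ n := by
          field_simp
          ring
  set κ := flowConst d p / (p - 2)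
  have hmain : ∀ᶠ n in atTop, κ * ((∫ z, u n z ∂(nuMeasure d)) ^ (1 / p)) ^ 2 ≤
      (1 + τ n) * E + 4 * τ n ^ 2 + 4 * τ n +
        κ * ∫ z, (u n z ^ (1 / p)) ^ 2 ∂(nuMeasure d) := by
    filter_upwards [hτ1] with n hn
    have h1 := interpolation_of_hasDerivAt hd hp hp' (fun z _ => hud n z)
      (hu'c n).continuousOn (hupos n hn) (hubal n)
    have h2 : ∫ z, flowDensity p κ (u n z) (u' n z) z ∂(nuMeasure d) =
        ∫ z, w' n z ^ 2 * nu z ∂(nuMeasure d) +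
          κ * ∫ z, (u n z ^ (1 / p)) ^ 2 ∂(nuMeasure d) := by
      have i1 : Integrable (fun z => (u n z ^ (1 / p)) ^ 2) (nuMeasure d) :=
        integrable_of_continuousOn hd ((hrc n hn (1 / p)).pow 2)
      rw [← integral_const_mul, ← integral_add (integrable_of_continuousOn hd (hw'c n hn))
        (i1.const_mul κ)]
      rfl
    rw [h2] at h1
    linarith [henergy n hn]
  have limL := ((lim1.rpow_const (p := 1 / p) (Or.inr (by positivity))).pow 2).const_mul κ
  have limR := ((((hτlim.const_add 1).mul_const E).add ((hτlim.pow 2).const_mul 4)).add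
    (hτlim.const_mul 4)).add (lim2.const_mul κ)
  have := le_of_tendsto_of_tendsto limL limR hmain
  simpa using this

/-! ### The upper bound on `λ⋆` -/

/-- The test function `z² + d / (d + 1)`. -/
lemma lambdaStar_le (hd : 2 ≤ d) (p : ℝ) : lambdaStar d p ≤ 2 * ((d : ℝ) + 1) := by
  have := isProbabilityMeasure hd
  have hd0 : (0 : ℝ) < d := by positivity
  -- The second eigenfunction `z² - 1/(d+1)`, with eigenvalue `2(d+1)`, shifted by `1` to be
  -- positive of mean one; evenness gives the balance for every `p`.
  set v : ℝ → ℝ := fun z => z ^ 2 + d / (d + 1) with hv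
  set v' : ℝ → ℝ := fun z => 2 * z with hv'
  set v'' : ℝ → ℝ := fun _ => 2 with hv''
  have hvpos : ∀ z, 0 < v z := fun z => by positivity
  have hvc : Continuous v := by fun_prop
  have hvd : ∀ z ∈ Icc (-1 : ℝ) 1, HasDerivAt v (v' z) z := fun z _ => by
    simpa [hv, hv'] using (hasDerivAt_pow 2 z).add_const ((d : ℝ) / (d + 1))
  have hv'd : ∀ z ∈ Icc (-1 : ℝ) 1, HasDerivAt v' (v'' z) z := fun z _ => by
    simpa using (hasDerivAt_id z).const_mul 2
  have hop : ∀ z, ultraOp d v' v'' z = 2 - 2 * (d + 1) * z ^ 2 := fun z => by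
    simp only [ultraOp, nu, hv', hv'']; ring
  have hopd : ∀ z ∈ Icc (-1 : ℝ) 1, HasDerivAt (ultraOp d v' v'') (-(2 * (d + 1) * (2 * z))) z :=
    fun z _ => by
      rw [funext hop]
      simpa using ((hasDerivAt_pow 2 z).const_mul (2 * ((d : ℝ) + 1))).const_sub 2
  have hnu := continuous_nu
  have hEc : Continuous fun z => v' z ^ 2 * nu z := by fun_prop
  have hopc : Continuous (ultraOp d v' v'') := by rw [funext hop]; fun_prop
  have hE : 0 < ∫ z, v' z ^ 2 * nu z ∂(nuMeasure d) := by
    rw [integral_pos_iff_support_of_nonneg_ae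
      (ae_mem_Icc.mono fun z hz => mul_nonneg (sq_nonneg _) (nu_nonneg hz))
      (integrable_of_continuousOn hd hEc.continuousOn)]
    have h0 : ∀ᵐ z ∂(nuMeasure d), z ≠ 0 :=
      (nuMeasure_absolutelyContinuous.trans Measure.restrict_le_self.absolutelyContinuous).ae_le
        (Measure.ae_ne volume 0)
    have : Function.support (fun z => v' z ^ 2 * nu z) =ᵐ[nuMeasure d] univ := by
      filter_upwards [ae_mem_Ioo, h0] with z hz hz0
      refine eq_true ?_
      have h1 := (nu_pos hz).ne'
      have h2 : v' z ≠ 0 := by simpa [hv'] using hz0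
      exact mul_ne_zero (pow_ne_zero 2 h2) h1
    rw [measure_congr this]
    simp
  have hodd : ∫ z, z * |v z| ^ p ∂(nuMeasure d) = 0 := by
    rw [integral_nuMeasure hd]
    have h := intervalIntegral.integral_comp_neg (a := (-1 : ℝ)) (b := 1)
      fun z => z * |v z| ^ p * weight d z
    simp only [neg_neg] at h
    have e : ∀ z : ℝ, -z * |v (-z)| ^ p * weight d (-z) = -(z * |v z| ^ p * weight d z) := by
      intro z
      simp only [hv, weight, nu, neg_sq]
      ring
    simp only [e] at h
    rw [intervalIntegral.integral_neg] at h
    linarith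
  have hadm : Admissible d p v v' v'' := by
    refine ⟨⟨memLp_of_continuousOn hd hvc.continuousOn _, hasWeakDeriv_of_hasDerivAt hvd
      (by fun_prop), integrable_of_continuousOn hd hEc.continuousOn⟩,
      hasWeakDeriv_of_hasDerivAt hv'd (by fun_prop), Eventually.of_forall fun z => (hvpos z).le,
      ?_, memLp_of_continuousOn hd hvc.continuousOn _, hodd,
      memLp_of_continuousOn hd hopc.continuousOn _, hE⟩
    rw [integral_add (integrable_of_continuousOn hd (by fun_prop)) (integrable_const _),
      integral_sq hd]
    simp
    field_simp
    ring
  -- Since `(𝓛v)' = -2(d+1) v'`, integrating `(𝓛v)(𝓛v)` by parts gives `2(d+1)` times the energy.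
  have hparts := integral_parts hd hopd hv'd (by fun_prop) (by fun_prop)
  have hratio : ∫ z, ultraOp d v' v'' z ^ 2 ∂(nuMeasure d) =
      2 * (d + 1) * ∫ z, v' z ^ 2 * nu z ∂(nuMeasure d) := by
    have i1 : Integrable (fun z => ultraOp d v' v'' z ^ 2) (nuMeasure d) :=
      integrable_of_continuousOn hd (hopc.pow 2).continuousOn
    rw [← sub_eq_zero, ← integral_const_mul, ← integral_sub i1
      ((integrable_of_continuousOn hd hEc.continuousOn).const_mul _), ← hparts]
    congr 1
    ext z
    simp only [ultraOp, hv', hv'']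
    ring
  refine csInf_le ⟨0, ?_⟩ ⟨v, v', v'', hadm, ?_⟩
  · rintro r ⟨v, v', v'', hv, rfl⟩
    exact div_nonneg (integral_nonneg fun z => sq_nonneg _) hv.energy_pos.le
  · rw [hratio, mul_div_assoc, div_self hE.ne', mul_one]

end Ultraspherical

end

theorem mainTheorem5 (d : ℕ) (hd : 2 ≤ d) (p : ℝ) (hp : 2 < p)
    (hp' : p < Ultraspherical.twoSharp d) :
    (∃ lam : ℝ,
      lam ≥ (d : ℝ) + ((d : ℝ) - 1) ^ 2 / ((d : ℝ) * ((d : ℝ) + 2)) *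
        (Ultraspherical.twoSharp d - p) * (Ultraspherical.lambdaStar d p - (d : ℝ)) ∧
      ∀ f f' : ℝ → ℝ, Ultraspherical.MemH1 d f f' →
        ∫ z, z * |f z| ^ p ∂(Ultraspherical.nuMeasure d) = 0 →
        MemLp f (ENNReal.ofReal p) (Ultraspherical.nuMeasure d) ∧
        (∫ z, f' z ^ 2 * Ultraspherical.nu z ∂(Ultraspherical.nuMeasure d)) +
            lam / (p - 2) * Ultraspherical.lqNorm d 2 f ^ 2 ≥
          lam / (p - 2) * Ultraspherical.lqNorm d p f ^ 2) ∧
    Ultraspherical.lambdaStar d p ≤ 2 * ((d : ℝ) + 1) := by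
  refine ⟨⟨Ultraspherical.flowConst d p, le_rfl, fun f f' hf hbal => ?_⟩,
    Ultraspherical.lambdaStar_le hd p⟩
  obtain ⟨hmem, hle⟩ := hf.interpolation hd hp hp' hbal
  have h2 : Ultraspherical.lqNorm d 2 f ^ 2 = ∫ z, f z ^ 2 ∂(Ultraspherical.nuMeasure d) := by
    have h0 : 0 ≤ ∫ z, f z ^ 2 ∂(Ultraspherical.nuMeasure d) :=
      integral_nonneg fun z => sq_nonneg _
    simp only [Ultraspherical.lqNorm, Real.rpow_two, sq_abs]
    rw [← Real.sqrt_eq_rpow, Real.sq_sqrt h0]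
  refine ⟨hmem, ?_⟩
  rw [h2]
  exact hle
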